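/- Let $\mathcal A$ be a measurable action set and $\mathcal F$ a class of functions $f:\mathcal A\to[0,C]$, $C>0$, carrying a $\sigma$-algebra for which the evaluation $(f,a)\mapsto f(a)$ is jointly measurable. Let $p_0$ be a prior on $\mathcal F$ for which $f\mapsto\sup_{a} f(a)$ is $p_0$-a.e. measurable, and let $f_0\sim p_0$. In round $t=1,\dots,T$ an action $a_t$ is played and the reward $R_t=f_0(a_t)+\eta_t$ is observed; put $\mathcal H_t=\sigma(a_1,R_1,\dots,a_t,R_t)$. The noise is $(\sigma^2,b)$-sub-exponential with $\sigma\ge 0$, $b>0$, in the sense that for each $t\le T$ and each real $s$ with $|s|\le 1/b$, the variable $e^{s\eta_t}$ is integrable and $$\mathbb E\big(e^{s\eta_t}\mid f_0,\mathcal H_{t-1},a_t\big)\le e^{s^2\sigma^2/2}\quad\text{almost surely.}$$ Actions are chosen by Thompson sampling: in round $t$ a function $\tilde f_{t-1}$ is drawn from the posterior of $f_0$ given $\mathcal H_{t-1}$, i.e. its conditional law given $(f_0,\mathcal H_{t-1})$ is the conditional law of $f_0$ given $\mathcal H_{t-1}$, and, almost surely, $a_t\in\arg\max_{a\in\mathcal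 A}\tilde f_{t-1}(a)$, ties being broken arbitrarily. The Bayesian regret is $BR(T)=\mathbb E\big[\sum_{t=1}^T(\sup_{a}f_0(a)-f_0(a_t))\big]$. An action $a$ is $\epsilon$-dependent on $a_1,\dots,a_n$ (for $\epsilon>0$) if for all $f,g\in\mathcal F$, $\sqrt{\sum_{i\le n}(f(a_i)-g(a_i))^2}\le\epsilon$ implies $f(a)-g(a)\le\epsilon$; otherwise it is $\epsilon$-independent of them. The eluder dimension $\dim_E(\mathcal F,\epsilon)\in\{0,1,\dots,\infty\}$ is the supremum of the lengths of sequences in $\mathcal A$ such that for some $\epsilon'\ge\epsilon$ with $\epsilon'>0$ every element is $\epsilon'$-independent of its predecessors. Let $N(\alpha)=N(\alpha,\mathcal F,\|\cdot\|_\infty)\in\{1,2,\dots,\infty\}$ be the least number of elements of $\mathcal F$ such that every $f\in\mathcal F$ is within sup-distance $\alpha$ of one of them. With $n_0=\sqrt{\tfrac{\delta}{4}\exp\tfrac{\sigma^2}{2b^2}}$ put $$\beta^*_n=\frac{2\alpha}{1-2\lambda\sigma^2}\Big[\frac{\log(N(\alpha)/\delta)}{2\lambda\alpha}+n(4C+\alpha)(1-\lambda\sigma^2)+\sum_{1\le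 i\le\lfloor n_0\rfloor}\sqrt{2\sigma^2\log(4i^2/\delta)}+\sum_{i=\lceil n_0\rceil}^{n}2b\log(4i^2/\delta)\Big],$$ with $\beta^*_n=\infty$ if $N(\alpha)=\infty$. Then for every horizon $T\ge1$, every nonincreasing $\kappa:\mathbb N\to[0,\infty)$, and all $\alpha>0$, $0<\delta\le 1/(2T)$, and $0<\lambda\le(2Cb)^{-1}$ with $2\lambda\sigma^2<1$, $$BR(T)\le T\kappa(T)+\big(\dim_E(\mathcal F,\kappa(T))+1\big)C+4\sqrt{\dim_E(\mathcal F,\kappa(T))\,\beta^*_T\,T},$$ where the right-hand side is read in $[0,\infty]$ with $0\cdot\infty=0$. -/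

import Mathlib

open MeasureTheory ProbabilityTheory
open scoped ENNReal NNReal

/-- The action `a` is `ε`-dependent on the actions `s 0, …, s (n - 1)` with respect to the
function class `F`. -/
def EpsDependent {A : Type*} (F : Set (A → ℝ)) (ε : ℝ) (s : ℕ → A) (n : ℕ) (a : A) : Prop :=
  ∀ f ∈ F, ∀ g ∈ F,
    Real.sqrt (∑ i ∈ Finset.range n, (f (s i) - g (s i)) ^ 2) ≤ ε → f a - g a ≤ ε

/-- The `ε`-eluder dimension of `F`: the supremum of the lengths `n` of the sequences
`s 0, …, s (n - 1)` such that, for some `ε' ≥ ε` with `ε' > 0`, every element is `ε'`-independent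
of its predecessors. Only the first `n` terms of `s` matter. -/
noncomputable def eluderDim {A : Type*} (F : Set (A → ℝ)) (ε : ℝ) : ℕ∞ :=
  ⨆ n ∈ {n : ℕ | ∃ ε' : ℝ, 0 < ε' ∧ ε ≤ ε' ∧
    ∃ s : ℕ → A, ∀ k < n, ¬ EpsDependent F ε' s k (s k)}, (n : ℕ∞)

/-- The covering number `N(α, F, ‖·‖_∞)`. The type `A →ᵤ ℝ` is `A → ℝ` with the uniform
(extended) distance `⨆ x, |f x - g x|`. -/
noncomputable def supCoveringNumber {A : Type*} (F : Set (A → ℝ)) (α : ℝ) : ℕ∞ :=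
  Metric.coveringNumber α.toNNReal (UniformFun.ofFun '' F : Set (UniformFun A ℝ))

/-- The threshold `n₀ = √((δ / 4) exp (σ² / (2 b²)))`. -/
noncomputable def noiseThreshold (σ b δ : ℝ) : ℝ :=
  Real.sqrt (δ / 4 * Real.exp (σ ^ 2 / (2 * b ^ 2)))

/-- The real formula for the ball-width function, as a function of the covering number `N`. -/
noncomputable def ballWidthFormula (N C σ b δ α l : ℝ) (n : ℕ) : ℝ :=
  2 * α / (1 - 2 * l * σ ^ 2) *
    (Real.log (N / δ) / (2 * l * α)
      + n * (4 * C + α) * (1 - l * σ ^ 2)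
      + ∑ i ∈ Finset.Icc 1 ⌊noiseThreshold σ b δ⌋₊,
          Real.sqrt (2 * σ ^ 2 * Real.log (4 * (i : ℝ) ^ 2 / δ))
      + ∑ i ∈ Finset.Icc ⌈noiseThreshold σ b δ⌉₊ n,
          2 * b * Real.log (4 * (i : ℝ) ^ 2 / δ))

open Classical in
/-- The ball-width function `β*_n(F, δ, α, l)` (for `l > 0`, `2 l σ² < 1`, `0 < δ ≤ 1`, where the
formula is nonnegative); it is infinite when the covering number is. -/
noncomputable def ballWidth {A : Type*} (F : Set (A → ℝ)) (C σ b δ α l : ℝ) (n : ℕ) : ℝ≥0∞ :=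
  if supCoveringNumber F α = ⊤ then ⊤
  else ENNReal.ofReal
    (ballWidthFormula ((supCoveringNumber F α).toNat : ℝ) C σ b δ α l n)

/-- The σ-algebra generated by the first `t` actions and rewards. Rounds are numbered from `0`,
so these are the rounds `0, …, t - 1`. -/
@[reducible] def history {Ω A : Type*} [MeasurableSpace A] (a : ℕ → Ω → A) (R : ℕ → Ω → ℝ) (t : ℕ) :
    MeasurableSpace Ω :=
  ⨆ i ∈ Finset.range t,
    (MeasurableSpace.comap (a i) inferInstance ⊔ MeasurableSpace.comap (R i) inferInstance)

/-- `η` is `(σ², b)`-sub-exponential conditionally on the σ-algebra `m`. -/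
def CondSubExponential {Ω : Type*} [MeasurableSpace Ω] (P : Measure Ω) (m : MeasurableSpace Ω)
    (η : Ω → ℝ) (σ b : ℝ) : Prop :=
  ∀ l : ℝ, |l| ≤ 1 / b →
    Integrable (fun ω => Real.exp (l * η ω)) P ∧
      P[fun ω => Real.exp (l * η ω) | m] ≤ᵐ[P] fun _ => Real.exp (l ^ 2 * σ ^ 2 / 2)

/-- The Bayesian bandit environment over `T` rounds: the reward function `f₀` is drawn from the
prior `p₀` on `F`, and the noise `η_t = R_t - f₀(a_t)` of each round is `(σ², b)`-sub-exponential
conditionally on the reward function, the past actions and rewards and the present action. -/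
structure IsBanditModel {Ω A : Type*} [MeasurableSpace Ω] [MeasurableSpace A] (P : Measure Ω)
    {F : Set (A → ℝ)} [MeasurableSpace F] (p₀ : Measure F) (σ b : ℝ) (T : ℕ)
    (f₀ : Ω → F) (a : ℕ → Ω → A) (R : ℕ → Ω → ℝ) : Prop where
  measurable_f₀ : Measurable f₀
  law_f₀ : P.map f₀ = p₀
  measurable_action : ∀ t < T, Measurable (a t)
  measurable_reward : ∀ t < T, Measurable (R t)
  noise : ∀ t < T, CondSubExponential P
    (MeasurableSpace.comap f₀ inferInstance ⊔ history a R t ⊔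
      MeasurableSpace.comap (a t) inferInstance)
    (fun ω => R t ω - (f₀ ω : A → ℝ) (a t ω)) σ b

/-- The actions `a` are chosen by Thompson sampling over `T` rounds. In round `t` a function `f' t`
is drawn from the posterior of `f₀` given the history (its conditional law given the history and
`f₀` is the conditional law of `f₀` given the history), and the action played maximises `f' t`. -/
structure IsThompsonSampling {Ω A : Type*} [MeasurableSpace Ω] [MeasurableSpace A] (P : Measure Ω)
    {F : Set (A → ℝ)} [MeasurableSpace F] (T : ℕ)
    (f₀ : Ω → F) (f' : ℕ → Ω → F) (a : ℕ → Ω → A) (R : ℕ → Ω → ℝ) : Prop where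
  measurable_sample : ∀ t < T, Measurable (f' t)
  posterior : ∀ t < T, ∀ S : Set F, MeasurableSet S →
    P⟦f' t ⁻¹' S | MeasurableSpace.comap f₀ inferInstance ⊔ history a R t⟧
      =ᵐ[P] P⟦f₀ ⁻¹' S | history a R t⟧
  argmax : ∀ t < T, ∀ᵐ ω ∂P, ∀ x : A, (f' t ω : A → ℝ) x ≤ (f' t ω : A → ℝ) (a t ω)

/-- The Bayesian regret over `T` rounds. The expectation is a Lebesgue integral; when the functions
in `F` are bounded, the integrand is nonnegative and `ENNReal.ofReal` truncates nothing. -/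
noncomputable def bayesRegret {Ω A : Type*} [MeasurableSpace Ω] (P : Measure Ω)
    {F : Set (A → ℝ)} (T : ℕ) (f₀ : Ω → F) (a : ℕ → Ω → A) : ℝ≥0∞ :=
  ∫⁻ ω, ENNReal.ofReal
    (∑ t ∈ Finset.range T, ((⨆ x : A, (f₀ ω : A → ℝ) x) - (f₀ ω : A → ℝ) (a t ω))) ∂P

/-!
The sampled function `f' t` has the same law as `f₀`, also jointly with the history, and the action
played maximises it. Hence the regret is the expectation of `∑ t, (f' t (a t) - f₀ (a t))`
(`bayesRegret_eq`), and it remains to bound the excess of one function over the other when both lie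
in a common confidence ball; each of the two misses its ball with probability at most `δ`, which
costs `2 T δ C ≤ C` in total.

*Confidence balls.* The ball of round `t` is centred at a least squares fit of the rewards within a
minimal `α`-cover `c` of `F`, not within `F`, so that only finitely many centres occur. If `c j` fits
no worse than the element `c (J f₀)` of the cover near `f₀`, and yet is far from `f₀`, then the
noise has a large correlation with `c j - c (J f₀)` (`le_exponent_of_fit_le`). For fixed `j` this
difference, evaluated at the actions played, is predictable, so the exponential supermartingale and
Markov's inequality give this event probability at most `δ / N`. Comparing with `c (J f₀)` rather
than with `f₀` means that the absolute values of the noise never have to be controlled: the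
corresponding sums in the ball width are only used through their sign, and the whole failure
probability `δ` is spent on the union bound over the cover.

The index `J f₀` has to be a measurable function of `f₀` for this, but sup-norm balls in `F`
need not be measurable. Replacing them by measurable hulls gives a measurable `J` for which `c (J f₀)`
is almost surely within `3 α` of `f₀` (`exists_measurable_near`). The loss of the factor `3` is
absorbed by the ball width, after `l` has been lowered to `1 / (4 σ²)` if it exceeds that value
(`exists_rate`).

*Widths.* On each trajectory, a round of width `> ε` cannot be `ε`-dependent on too many disjoint
sets of earlier rounds, so the rounds of large width can be distributed over a bounded number of
`ε`-independent sequences, each of length at most the eluder dimension (`card_large_width_le`).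
Summing the widths in decreasing order gives `T κ + d C + 4 √(d β T)` (`sum_width_le`).
-/

/-! ### Eluder dimension and the sum of widths -/

/-- The actions `x i`, `i ∈ S`, in increasing order of `i`, form an `ε`-independent sequence: each is
separated from its predecessors by a pair of functions in `F`. -/
def IsEluderIndep {A : Type*} (F : Set (A → ℝ)) (ε : ℝ) (x : ℕ → A) (S : Finset ℕ) : Prop :=
  ∀ t ∈ S, ∃ f ∈ F, ∃ g ∈ F,
    Real.sqrt (∑ i ∈ S with i < t, (f (x i) - g (x i)) ^ 2) ≤ ε ∧ ε < f (x t) - g (x t)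

theorem IsEluderIndep.exists_seq {A : Type*} {F : Set (A → ℝ)} {ε : ℝ} {x : ℕ → A} (m : ℕ) :
    ∀ {S : Finset ℕ}, S ⊆ Finset.range m → IsEluderIndep F ε x S →
      ∃ s : ℕ → A, (∀ k < S.card, ¬ EpsDependent F ε s k (s k)) ∧
        ∀ h : A → ℝ, ∑ k ∈ Finset.range S.card, h (s k) = ∑ i ∈ S, h (x i) := by
  induction m with
  | zero =>
    intro S hS _
    have : S = ∅ := by simpa using hS
    subst this
    exact ⟨x, by simp, by simp⟩
  | succ m ih =>
    intro S hS hind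
    by_cases hm : m ∈ S
    · have hsub : S.erase m ⊆ Finset.range m := by
        intro i hi
        have h1 := Finset.mem_range.1 (hS (Finset.mem_of_mem_erase hi))
        have h2 := Finset.ne_of_mem_erase hi
        exact Finset.mem_range.2 (by omega)
      have hfil : S.filter (· < m) = S.erase m := by
        ext i
        simp only [Finset.mem_filter, Finset.mem_erase]
        constructor
        · rintro ⟨h1, h2⟩; exact ⟨by omega, h1⟩
        · rintro ⟨h1, h2⟩
          have := Finset.mem_range.1 (hS h2)
          exact ⟨h2, by omega⟩
      have hind' : IsEluderIndep F ε x (S.erase m) := by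
        intro t ht
        obtain ⟨f, hf, g, hg, h1, h2⟩ := hind t (Finset.mem_of_mem_erase ht)
        refine ⟨f, hf, g, hg, ?_, h2⟩
        have htm := Finset.mem_range.1 (hsub ht)
        have : (S.erase m).filter (· < t) = S.filter (· < t) := by
          ext i
          simp only [Finset.mem_filter, Finset.mem_erase]
          constructor
          · rintro ⟨⟨_, h⟩, h'⟩; exact ⟨h, h'⟩
          · rintro ⟨h, h'⟩; exact ⟨⟨by omega, h⟩, h'⟩
        rwa [this]
      obtain ⟨s, hs, hsum⟩ := ih hsub hind'
      set n := (S.erase m).card with hn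
      have hcard : S.card = n + 1 := by rw [hn, Finset.card_erase_add_one hm]
      have hlt : ∀ k < n, Function.update s n (x m) k = s k := fun k hk =>
        Function.update_of_ne (by omega) _ _
      have hself : Function.update s n (x m) n = x m := Function.update_self ..
      have hsum' : ∀ h : A → ℝ, ∀ k ≤ n,
          ∑ i ∈ Finset.range k, h (Function.update s n (x m) i)
            = ∑ i ∈ Finset.range k, h (s i) := by
        intro h k hk
        refine Finset.sum_congr rfl fun i hi => ?_
        rw [hlt i (by have := Finset.mem_range.1 hi; omega)]
      refine ⟨Function.update s n (x m), ?_, ?_⟩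
      · intro k hk
        rw [hcard] at hk
        rcases Nat.lt_succ_iff_lt_or_eq.1 hk with hk | rfl
        · have := hs k hk
          rw [hlt k hk]
          unfold EpsDependent at this ⊢
          simpa only [fun f g : A → ℝ => hsum' (fun a => (f a - g a) ^ 2) k hk.le] using this
        · obtain ⟨f, hf, g, hg, h1, h2⟩ := hind m hm
          intro hdep
          have := hdep f hf g hg
          rw [hsum' (fun a => (f a - g a) ^ 2) n le_rfl,
            hsum (fun a => (f a - g a) ^ 2), ← hfil, hself] at this
          exact absurd (this h1) (not_le.2 h2)
      · intro h
        rw [hcard, Finset.sum_range_succ, hsum' h n le_rfl, hsum, hself,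
          Finset.sum_erase_add _ _ hm]
    · refine ih (fun i hi => ?_) hind
      have h1 := Finset.mem_range.1 (hS hi)
      have h2 : i ≠ m := fun h => hm (h ▸ hi)
      exact Finset.mem_range.2 (by omega)

theorem IsEluderIndep.card_le {A : Type*} {F : Set (A → ℝ)} {κ ε : ℝ} {x : ℕ → A} {S : Finset ℕ}
    (hS : IsEluderIndep F ε x S) (hε : 0 < ε) (hκ : κ ≤ ε) {d : ℕ} (hd : eluderDim F κ = d) :
    S.card ≤ d := by
  obtain ⟨m, hm⟩ : ∃ m, S ⊆ Finset.range m :=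
    ⟨S.sup id + 1, fun i hi => Finset.mem_range.2
      (Nat.lt_succ_of_le (Finset.le_sup (f := id) hi))⟩
  obtain ⟨s, hs, -⟩ := hS.exists_seq m hm
  have : (S.card : ℕ∞) ≤ eluderDim F κ := by
    unfold eluderDim
    exact le_iSup₂ (f := fun (n : ℕ) (_ : n ∈ {n : ℕ | ∃ ε' : ℝ, 0 < ε' ∧ κ ≤ ε' ∧
      ∃ s : ℕ → A, ∀ k < n, ¬ EpsDependent F ε' s k (s k)}) => (n : ℕ∞)) S.card ⟨ε, hε, hκ, s, hs⟩
  rw [hd] at this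
  exact_mod_cast this

/-- If the round `t` has a width `> ε` realised by a pair of functions at empirical squared distance
at most `K ε²`, then `x t` cannot be `ε`-dependent on `K` disjoint sets of earlier actions; so
the rounds of large width can be distributed greedily over `K` independent sequences. -/
theorem exists_bucket {A : Type*} {F : Set (A → ℝ)} {ε : ℝ} (hε : 0 < ε) {x : ℕ → A}
    {f g : ℕ → A → ℝ} (hf : ∀ t, f t ∈ F) (hg : ∀ t, g t ∈ F) {S : Finset ℕ} {K : ℕ} (hK : 0 < K)
    (hwidth : ∀ t ∈ S, ε < f t (x t) - g t (x t))
    (hball : ∀ t ∈ S, ∑ i ∈ Finset.range t, (f t (x i) - g t (x i)) ^ 2 ≤ K * ε ^ 2) (m : ℕ) :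
    ∃ c : ℕ → Fin K, ∀ j, IsEluderIndep F ε x {t ∈ S | t < m ∧ c t = j} := by
  induction m with
  | zero => exact ⟨fun _ => ⟨0, hK⟩, fun j t ht => by simp at ht⟩
  | succ m ih =>
    obtain ⟨c, hc⟩ := ih
    by_cases hm : m ∈ S
    · obtain ⟨j, hj⟩ : ∃ j : Fin K,
          ∑ i ∈ S with i < m ∧ c i = j, (f m (x i) - g m (x i)) ^ 2 ≤ ε ^ 2 := by
        by_contra! hcon
        have : Nonempty (Fin K) := ⟨⟨0, hK⟩⟩
        have h1 : ∑ _j : Fin K, ε ^ 2 <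
            ∑ j : Fin K, ∑ i ∈ S with i < m ∧ c i = j, (f m (x i) - g m (x i)) ^ 2 :=
          Finset.sum_lt_sum_of_nonempty Finset.univ_nonempty fun j _ => hcon j
        have h2 : ∑ j : Fin K, ∑ i ∈ S with i < m ∧ c i = j, (f m (x i) - g m (x i)) ^ 2
            = ∑ i ∈ S with i < m, (f m (x i) - g m (x i)) ^ 2 := by
          rw [← Finset.sum_fiberwise (S.filter (· < m)) c]
          simp only [Finset.filter_filter]
        have h3 : ∑ i ∈ S with i < m, (f m (x i) - g m (x i)) ^ 2
            ≤ ∑ i ∈ Finset.range m, (f m (x i) - g m (x i)) ^ 2 :=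
          Finset.sum_le_sum_of_subset_of_nonneg
            (fun i hi => Finset.mem_range.2 (Finset.mem_filter.1 hi).2)
            fun _ _ _ => sq_nonneg _
        have h4 := hball m hm
        simp only [Finset.sum_const, Finset.card_univ, Fintype.card_fin, nsmul_eq_mul] at h1
        linarith
      refine ⟨Function.update c m j, fun k t ht => ?_⟩
      simp only [Finset.mem_filter] at ht
      obtain ⟨htS, htm, htk⟩ := ht
      have hfil : ∀ t ≤ m, ∀ k, {i ∈ {i ∈ S | i < m + 1 ∧ Function.update c m j i = k} | i < t}
          = {i ∈ {i ∈ S | i < m ∧ c i = k} | i < t} := by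
        intro t ht k
        ext i
        simp only [Finset.mem_filter]
        constructor
        · rintro ⟨⟨h1, h2, h3⟩, h4⟩
          rw [Function.update_of_ne (by omega)] at h3
          exact ⟨⟨h1, by omega, h3⟩, h4⟩
        · rintro ⟨⟨h1, h2, h3⟩, h4⟩
          refine ⟨⟨h1, by omega, ?_⟩, h4⟩
          rwa [Function.update_of_ne (by omega)]
      rw [hfil t (by omega)]
      rcases Nat.lt_succ_iff_lt_or_eq.1 htm with h | rfl
      · rw [Function.update_of_ne (by omega)] at htk
        exact hc k t (by simp [htS, h, htk])
      · rw [Function.update_self] at htk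
        subst htk
        refine ⟨f t, hf t, g t, hg t, ?_, hwidth t hm⟩
        rw [Finset.filter_filter]
        have : (S.filter fun i => (i < t ∧ c i = j) ∧ i < t) = S.filter fun i => i < t ∧ c i = j :=
          Finset.filter_congr fun i _ => by tauto
        rw [this]
        exact Real.sqrt_le_iff.2 ⟨hε.le, hj⟩
    · refine ⟨c, fun j => ?_⟩
      have : (S.filter fun t => t < m + 1 ∧ c t = j) = S.filter fun t => t < m ∧ c t = j := by
        refine Finset.filter_congr fun i hi => ?_
        have : i ≠ m := fun h => hm (h ▸ hi)
        constructor <;> rintro ⟨h1, h2⟩ <;> exact ⟨by omega, h2⟩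
      rw [this]
      exact hc j

theorem card_large_width_le {A : Type*} {F : Set (A → ℝ)} {κ ε : ℝ} (hε : 0 < ε) (hκ : κ ≤ ε)
    {d : ℕ} (hd : eluderDim F κ = d) {x : ℕ → A} {f g : ℕ → A → ℝ} (hf : ∀ t, f t ∈ F)
    (hg : ∀ t, g t ∈ F) {β : ℝ} (hβ : 0 ≤ β) {S : Finset ℕ}
    (hwidth : ∀ t ∈ S, ε < f t (x t) - g t (x t))
    (hball : ∀ t ∈ S, ∑ i ∈ Finset.range t, (f t (x i) - g t (x i)) ^ 2 ≤ 4 * β) :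
    (S.card : ℝ) ≤ d + 4 * (d * β) / ε ^ 2 := by
  have hε2 : 0 < ε ^ 2 := by positivity
  set K := ⌊4 * β / ε ^ 2⌋₊ + 1 with hK
  have h1 : 4 * β ≤ K * ε ^ 2 := by
    rw [← div_le_iff₀ hε2, hK]
    push_cast
    exact (Nat.lt_floor_add_one _).le
  have h2 : (K : ℝ) ≤ 4 * β / ε ^ 2 + 1 := by
    rw [hK]
    push_cast
    gcongr
    exact Nat.floor_le (by positivity)
  obtain ⟨m, hm⟩ : ∃ m, S ⊆ Finset.range m :=
    ⟨S.sup id + 1, fun i hi => Finset.mem_range.2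
      (Nat.lt_succ_of_le (Finset.le_sup (f := id) hi))⟩
  obtain ⟨c, hc⟩ := exists_bucket hε hf hg (Nat.succ_pos _ : 0 < K) hwidth
    (fun t ht => (hball t ht).trans h1) m
  have h3 : S.card = ∑ j : Fin K, (S.filter fun t => t < m ∧ c t = j).card := by
    rw [Finset.card_eq_sum_card_fiberwise (f := c) (t := Finset.univ) (by simp)]
    refine Finset.sum_congr rfl fun j _ => congrArg _ (Finset.filter_congr fun i hi => ?_)
    have := Finset.mem_range.1 (hm hi)
    tauto
  have h4 : S.card ≤ K * d := by
    rw [h3]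
    refine (Finset.sum_le_sum fun j _ => (hc j).card_le hε hκ hd).trans ?_
    simp [K]
  have h5 : (S.card : ℝ) ≤ K * d := by exact_mod_cast h4
  calc (S.card : ℝ) ≤ K * d := h5
    _ ≤ (4 * β / ε ^ 2 + 1) * d := by gcongr
    _ = _ := by ring

/-- Summation of widths from the bounds on the number of large ones. With the widths sorted in
decreasing order, the first `d` are bounded by `C` and the `(d + k)`-th by `2 √(v / k)`, or else by
`κ`. -/
theorem sum_le_of_card_large_le {κ C v : ℝ} (hκ : 0 ≤ κ) (hC : 0 ≤ C) (hv : 0 ≤ v) {d : ℕ}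
    {u : ℕ → ℝ} (n : ℕ) : ∀ S : Finset ℕ, S.card = n → (∀ t ∈ S, u t ≤ C) →
      (∀ ε, 0 < ε → κ ≤ ε → (({t ∈ S | ε < u t} : Finset ℕ).card : ℝ) ≤ d + 4 * v / ε ^ 2) →
      ∑ t ∈ S, u t ≤ n * κ + (min n d : ℕ) * C + 4 * Real.sqrt v * Real.sqrt ((n - d : ℕ) : ℝ) := by
  induction n with
  | zero =>
    intro S hS _ _
    rw [Finset.card_eq_zero.1 hS]
    simp
  | succ n ih =>
    intro S hS hSC hcount
    have hne : S.Nonempty := Finset.card_pos.1 (by omega)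
    obtain ⟨t, ht, hmin⟩ := S.exists_min_image u hne
    have hIH := ih (S.erase t) (by rw [Finset.card_erase_of_mem ht, hS]; rfl)
      (fun s hs => hSC s (Finset.mem_of_mem_erase hs)) (fun ε hε hκε => by
        refine le_trans ?_ (hcount ε hε hκε)
        exact_mod_cast Finset.card_le_card
          (Finset.filter_subset_filter _ (Finset.erase_subset _ _)))
    rw [← Finset.sum_erase_add _ _ ht]
    have hmono1 : ((min n d : ℕ) : ℝ) * C ≤ (min (n + 1) d : ℕ) * C := by
      gcongr; omega
    have hmono2 : 4 * Real.sqrt v * Real.sqrt ((n - d : ℕ) : ℝ) ≤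
        4 * Real.sqrt v * Real.sqrt ((n + 1 - d : ℕ) : ℝ) := by
      gcongr; omega
    clear ih
    have hcast : ((n + 1 : ℕ) : ℝ) * κ = n * κ + κ := by push_cast; ring
    rw [hcast]
    rcases le_or_gt (u t) κ with h | h
    · linarith
    rcases le_or_gt (n + 1) d with hnd | hnd
    · have h1 : min (n + 1) d = n + 1 := by omega
      have h2 : min n d = n := by omega
      have := hSC t ht
      rw [h2] at hIH
      rw [h1, Nat.cast_succ, add_one_mul]
      linarith
    obtain ⟨k, rfl⟩ : ∃ k, n = d + k := ⟨n - d, by omega⟩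
    have e1 : d + k + 1 - d = k + 1 := by omega
    have e2 : d + k - d = k := by omega
    rw [e1]
    rw [e2] at hIH
    -- Every admissible `ε` below the smallest width is exceeded by all `d + k + 1` widths.
    have hε : ∀ ε, 0 < ε → κ ≤ ε → ε < u t → ε * Real.sqrt (k + 1 : ℕ) ≤ 2 * Real.sqrt v := by
      intro ε hε hκε hεt
      have h1 := hcount ε hε hκε
      rw [Finset.filter_true_of_mem (fun s hs => hεt.trans_le (hmin s hs)), hS] at h1
      push_cast at h1
      have h2 : ((k : ℝ) + 1) ≤ 4 * v / ε ^ 2 := by linarith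
      rw [le_div_iff₀ (by positivity)] at h2
      refine abs_le_of_sq_le_sq' ?_ (by positivity) |>.2
      rw [mul_pow, mul_pow, Real.sq_sqrt (by positivity), Real.sq_sqrt hv]
      push_cast
      linarith
    have hut : u t * Real.sqrt (k + 1 : ℕ) ≤ 2 * Real.sqrt v := by
      have hpos : 0 < Real.sqrt ((k + 1 : ℕ) : ℝ) := Real.sqrt_pos.2 (by positivity)
      rw [← le_div_iff₀ hpos]
      refine le_of_forall_lt_imp_le_of_dense fun ε hε' => ?_
      have hmax : max ε ((κ + u t) / 2) < u t := max_lt hε' (by linarith)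
      have := hε (max ε ((κ + u t) / 2)) (lt_max_of_lt_right (by linarith))
        (le_max_of_le_right (by linarith)) hmax
      rw [← le_div_iff₀ hpos] at this
      exact (le_max_left _ _).trans this
    have hkey : u t ≤ 4 * Real.sqrt v * (Real.sqrt (k + 1 : ℕ) - Real.sqrt (k : ℕ)) := by
      have hpos : 0 < Real.sqrt ((k + 1 : ℕ) : ℝ) := Real.sqrt_pos.2 (by positivity)
      have hs1 := Real.sq_sqrt (show (0 : ℝ) ≤ ((k + 1 : ℕ) : ℝ) by positivity)
      have hs0 := Real.sq_sqrt (show (0 : ℝ) ≤ (k : ℝ) by positivity)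
      have hle : Real.sqrt (k : ℝ) ≤ Real.sqrt ((k + 1 : ℕ) : ℝ) := by gcongr; omega
      push_cast at hs1
      set p := Real.sqrt ((k + 1 : ℕ) : ℝ)
      set q := Real.sqrt (k : ℝ)
      have hq : 0 ≤ q := Real.sqrt_nonneg _
      have hpq : 1 ≤ 2 * p * (p - q) := by push_cast [p, q] at *; nlinarith [sq_nonneg (p - q)]
      refine le_of_mul_le_mul_right (hut.trans ?_) hpos
      have := mul_le_mul_of_nonneg_left hpq (mul_nonneg zero_le_two (Real.sqrt_nonneg v))
      linarith
    linarith

/-- The eluder bound on the regret of one trajectory: `S` is the set of rounds in which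
the sampled and the true function are both in the confidence ball. -/
theorem sum_width_le {A : Type*} {F : Set (A → ℝ)} {κ C : ℝ} (hκ : 0 ≤ κ) (hC : 0 ≤ C)
    {d : ℕ} (hd : eluderDim F κ = d) {x : ℕ → A} {f g : ℕ → A → ℝ} (hf : ∀ t, f t ∈ F)
    (hg : ∀ t, g t ∈ F) {β : ℝ} (hβ : 0 ≤ β) {T : ℕ} {S : Finset ℕ} (hST : S ⊆ Finset.range T)
    (hwidth : ∀ t ∈ S, f t (x t) - g t (x t) ≤ C)
    (hball : ∀ t ∈ S, ∑ i ∈ Finset.range t, (f t (x i) - g t (x i)) ^ 2 ≤ 4 * β) :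
    ∑ t ∈ S, (f t (x t) - g t (x t)) ≤ T * κ + d * C + 4 * Real.sqrt (d * β * T) := by
  have hcard : S.card ≤ T := by simpa using Finset.card_le_card hST
  refine (sum_le_of_card_large_le (v := d * β) hκ hC (by positivity) S.card S rfl hwidth
    fun ε hε hκε => card_large_width_le hε hκε hd hf hg hβ (fun t ht => (Finset.mem_filter.1 ht).2)
      fun t ht => hball t (Finset.mem_filter.1 ht).1).trans ?_
  rw [Real.sqrt_mul (by positivity : 0 ≤ d * β), ← mul_assoc]
  gcongr
  · exact min_le_right _ _
  · omega

/-! ### Finite covers -/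

theorem exists_finset_cover {A : Type*} {F : Set (A → ℝ)} {α : ℝ} (hα : 0 ≤ α)
    (hN : supCoveringNumber F α ≠ ⊤) :
    ∃ c : Finset (A → ℝ), (∀ f ∈ c, f ∈ F) ∧ (c.card : ℝ) = (supCoveringNumber F α).toNat ∧
      ∀ f ∈ F, ∃ g ∈ c, ∀ x, |f x - g x| ≤ α := by
  classical
  obtain ⟨N, hNF, hfin, hcov, hcard⟩ := Metric.exists_set_encard_eq_coveringNumber hN
  refine ⟨hfin.toFinset.image UniformFun.toFun, ?_, ?_, ?_⟩
  · intro f hf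
    simp only [Finset.mem_image, Set.Finite.mem_toFinset] at hf
    obtain ⟨g, hg, rfl⟩ := hf
    obtain ⟨h, hh, rfl⟩ := hNF hg
    exact hh
  · rw [Finset.card_image_of_injective _ UniformFun.toFun.injective]
    unfold supCoveringNumber
    rw [← hcard, hfin.encard_eq_coe_toFinset_card, ENat.toNat_natCast]
  · intro f hf
    obtain ⟨g, hg, hfg⟩ := hcov ⟨f, hf, rfl⟩
    refine ⟨UniformFun.toFun g, by simpa using hg, fun x => ?_⟩
    have := UniformFun.edist_le.1 hfg x
    rw [edist_dist, ← ENNReal.ofReal_coe_nnreal, Real.coe_toNNReal _ hα,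
      ENNReal.ofReal_le_ofReal_iff hα, Real.dist_eq] at this
    exact this

/-- A finite cover of radius `α` admits a measurable choice of centre, at the price of the radius
`3 α`. The cells `{f | f is within α of g}` need not be measurable; but if the measurable hulls
of two cells meet in a set of positive measure then, at each fixed point `x`, almost every function
there is within `α` of both centres, so these centres are within `2 α` of each other. -/
theorem exists_measurable_near {A : Type*} {F : Set (A → ℝ)} [MeasurableSpace F]
    (heval : ∀ x : A, Measurable fun f : F => (f : A → ℝ) x) (μ : Measure F) [IsFiniteMeasure μ]
    {N : ℕ} {c : Fin N → A → ℝ} {α : ℝ} (hc : ∀ f ∈ F, ∃ j, ∀ x, |f x - c j x| ≤ α) :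
    ∃ J : F → Fin N, Measurable J ∧ ∀ᵐ f : F ∂μ, ∀ x, |(f : A → ℝ) x - c (J f) x| ≤ 3 * α := by
  classical
  set U : Fin N → Set F := fun j => {f | ∀ x, |(f : A → ℝ) x - c j x| ≤ α} with hU
  set H : Fin N → Set F := fun j => toMeasurable μ (U j) with hH
  have hHm : ∀ j, MeasurableSet (H j) := fun j => measurableSet_toMeasurable _ _
  have hUH : ∀ j, U j ⊆ H j := fun j => subset_toMeasurable _ _
  have hclose : ∀ j x, ∀ᵐ f ∂μ, f ∈ H j → |(f : A → ℝ) x - c j x| ≤ α := by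
    intro j x
    have hV : MeasurableSet {f : F | ¬ |(f : A → ℝ) x - c j x| ≤ α} :=
      (measurableSet_le (((heval x).sub measurable_const).abs) measurable_const).compl
    have h0 : μ (H j ∩ {f : F | ¬ |(f : A → ℝ) x - c j x| ≤ α}) = 0 := by
      rw [Measure.measure_toMeasurable_inter hV (measure_ne_top _ _)]
      have : U j ∩ {f : F | ¬ |(f : A → ℝ) x - c j x| ≤ α} = ∅ :=
        Set.eq_empty_of_forall_notMem fun f hf => hf.2 (hf.1 x)
      rw [this, measure_empty]
    rw [ae_iff]
    convert h0 using 2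
    ext f
    simp
  have hpair : ∀ j k, ∀ᵐ f ∂μ, f ∈ H j → f ∈ H k → ∀ x, |c j x - c k x| ≤ 2 * α := by
    intro j k
    by_cases h : ∀ x, |c j x - c k x| ≤ 2 * α
    · exact Filter.Eventually.of_forall fun _ _ _ => h
    · push Not at h
      obtain ⟨x, hx⟩ := h
      filter_upwards [hclose j x, hclose k x] with f h1 h2 hj hk
      have h1 := abs_le.1 (h1 hj)
      have h2 := abs_le.1 (h2 hk)
      exact absurd (abs_le.2 ⟨by linarith, by linarith⟩) (not_le.2 hx)
  have hne : ∀ f : F, (Finset.univ.filter fun j => f ∈ H j).Nonempty := by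
    intro f
    obtain ⟨j, hj⟩ := hc f f.2
    exact ⟨j, by simpa using hUH j hj⟩
  have hmin : ∀ f, f ∈ H ((Finset.univ.filter fun j => f ∈ H j).min' (hne f)) := fun f =>
    (Finset.mem_filter.1 (Finset.min'_mem _ (hne f))).2
  refine ⟨fun f => (Finset.univ.filter fun j => f ∈ H j).min' (hne f), ?_, ?_⟩
  · refine measurable_to_countable' fun j => ?_
    have : (fun f => (Finset.univ.filter fun j => f ∈ H j).min' (hne f)) ⁻¹' {j}
        = H j ∩ ⋂ k, ⋂ (_ : k < j), (H k)ᶜ := by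
      ext f
      simp only [Set.mem_preimage, Set.mem_singleton_iff, Set.mem_inter_iff, Set.mem_iInter,
        Set.mem_compl_iff]
      constructor
      · rintro rfl
        refine ⟨hmin f, fun k hk hkH => ?_⟩
        exact absurd (Finset.min'_le _ k (by simpa using hkH)) (not_le.2 hk)
      · rintro ⟨h1, h2⟩
        refine le_antisymm (Finset.min'_le _ j (by simpa using h1)) ?_
        by_contra! hlt
        exact h2 _ hlt (hmin f)
    rw [this]
    exact (hHm j).inter (MeasurableSet.iInter fun k => MeasurableSet.iInter fun _ => (hHm k).compl)
  · filter_upwards [ae_all_iff.2 fun j => ae_all_iff.2 (hpair j)] with f hf x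
    obtain ⟨k, hk⟩ := hc f f.2
    have h1 := abs_le.1 (hk x)
    have h2 := abs_le.1 (hf _ _ (hUH k hk) (hmin f) x)
    exact abs_le.2 ⟨by linarith, by linarith⟩

/-! ### The width of the confidence ball -/

/-- The rate `r` at which the exponential moments are used: the smaller of `l` and the value
`1 / (4 σ²)`, which maximises `r (1 - 2 r σ²)`. -/
theorem exists_rate {N C σ b δ α l : ℝ} {T : ℕ} (hN : 1 ≤ N) (hC : 0 < C) (hb : 0 < b)
    (hα : 0 < α) (hδ : 0 < δ) (hδ1 : δ ≤ 1) (hl : 0 < l) (hlσ : 2 * l * σ ^ 2 < 1) :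
    ∃ r, 0 < r ∧ r ≤ l ∧ 0 ≤ 1 - 2 * r * σ ^ 2 ∧
      Real.log (N / δ) / r + 3 * (1 + 2 * r * σ ^ 2) * C * α * T ≤
        (1 - 2 * r * σ ^ 2) * ballWidthFormula N C σ b δ α l T := by
  have hlog : 0 ≤ Real.log (N / δ) := Real.log_nonneg ((one_le_div hδ).2 (hδ1.trans hN))
  have hD : 0 < 1 - 2 * l * σ ^ 2 := by linarith
  have hlog4 : ∀ i : ℕ, 0 ≤ Real.log (4 * (i : ℝ) ^ 2 / δ) := by
    intro i
    rcases Nat.eq_zero_or_pos i with rfl | hi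
    · simp
    · refine Real.log_nonneg ((one_le_div hδ).2 ?_)
      have : (1 : ℝ) ≤ i := by exact_mod_cast hi
      nlinarith
  set S₁ := ∑ i ∈ Finset.Icc 1 ⌊noiseThreshold σ b δ⌋₊,
    Real.sqrt (2 * σ ^ 2 * Real.log (4 * (i : ℝ) ^ 2 / δ)) with hS₁
  set S₂ := ∑ i ∈ Finset.Icc ⌈noiseThreshold σ b δ⌉₊ T,
    2 * b * Real.log (4 * (i : ℝ) ^ 2 / δ) with hS₂
  have h1 : 0 ≤ S₁ := Finset.sum_nonneg fun _ _ => Real.sqrt_nonneg _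
  have h2 : 0 ≤ S₂ := Finset.sum_nonneg fun i _ => mul_nonneg (by positivity) (hlog4 i)
  have hT : (0 : ℝ) ≤ T := Nat.cast_nonneg T
  have hB : Real.log (N / δ) / l + 8 * C * α * T * (1 - l * σ ^ 2) ≤
      (1 - 2 * l * σ ^ 2) * ballWidthFormula N C σ b δ α l T := by
    have : (1 - 2 * l * σ ^ 2) * ballWidthFormula N C σ b δ α l T
        = Real.log (N / δ) / l + 2 * α * (T * (4 * C + α) * (1 - l * σ ^ 2))
          + 2 * α * (S₁ + S₂) := by
      unfold ballWidthFormula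
      rw [← hS₁, ← hS₂]
      field_simp
      ring
    rw [this]
    have h3 : 0 ≤ 2 * α * (S₁ + S₂) := by positivity
    have h4 : 0 ≤ 2 * α ^ 2 * T * (1 - l * σ ^ 2) := by
      have : 0 ≤ 1 - l * σ ^ 2 := by nlinarith [mul_nonneg hl.le (sq_nonneg σ)]
      positivity
    linarith
  rcases le_or_gt (4 * l * σ ^ 2) 1 with h | h
  · refine ⟨l, hl, le_rfl, hD.le, le_trans ?_ hB⟩
    have h5 : 0 ≤ C * α * T := by positivity
    nlinarith [mul_nonneg h5 (by linarith : 0 ≤ 1 - 4 * l * σ ^ 2)]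
  · have hσ2 : 0 < σ ^ 2 := by
      rcases (sq_nonneg σ).eq_or_lt with h0 | h0
      · rw [← h0] at h; norm_num at h
      · exact h0
    have hr : 1 / (4 * σ ^ 2) * σ ^ 2 = 1 / 4 := by
      rw [div_mul_eq_mul_div, div_eq_div_iff (by positivity) (by norm_num)]; ring
    refine ⟨1 / (4 * σ ^ 2), by positivity, ?_, ?_, ?_⟩
    · rw [div_le_iff₀ (by positivity)]; linarith
    · rw [mul_assoc, hr]; norm_num
    · rw [mul_assoc 2 _ (σ ^ 2), hr]
      set B := ballWidthFormula N C σ b δ α l T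
      have h5 : 0 ≤ C * α * T := by positivity
      -- `l (1 - 2 l σ²) ≤ 1 / (8 σ²)`, the maximum being attained at the rate `1 / (4 σ²)`.
      have h6 : 8 * σ ^ 2 * (1 - 2 * l * σ ^ 2) ≤ 1 / l := by
        rw [le_div_iff₀ hl]
        nlinarith [sq_nonneg (4 * l * σ ^ 2 - 1)]
      have h7 : (1 - 2 * l * σ ^ 2) * (8 * σ ^ 2 * Real.log (N / δ) + 9 * (C * α * T)) ≤
          (1 - 2 * l * σ ^ 2) * B := by
        refine le_trans ?_ hB
        have h8 := mul_le_mul_of_nonneg_right h6 hlog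
        rw [one_div_mul_eq_div] at h8
        nlinarith [mul_nonneg h5 (by linarith : 0 ≤ 4 * l * σ ^ 2 - 1)]
      have h9 := le_of_mul_le_mul_left h7 hD
      have h10 : Real.log (N / δ) / (1 / (4 * σ ^ 2)) = 4 * σ ^ 2 * Real.log (N / δ) := by
        field_simp
      rw [h10]
      linarith

/-! ### Exponential moments along a predictable sequence -/

/-- The moment bound of a conditionally sub-exponential variable, integrated against
a nonnegative `m`-measurable weight. -/
theorem CondSubExponential.lintegral_mul_exp_le {Ω : Type*} {m mΩ : MeasurableSpace Ω}
    {P : Measure Ω} [IsFiniteMeasure P] (hm : m ≤ mΩ) {η : Ω → ℝ}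
    {σ b : ℝ} (h : CondSubExponential P m η σ b) {l : ℝ} (hl : |l| ≤ 1 / b)
    {Z : Ω → ℝ≥0∞} (hZ : Measurable[m] Z) :
    ∫⁻ ω, Z ω * ENNReal.ofReal (Real.exp (l * η ω)) ∂P ≤
      ∫⁻ ω, Z ω * ENNReal.ofReal (Real.exp (l ^ 2 * σ ^ 2 / 2)) ∂P := by
  obtain ⟨hint, hle⟩ := h l hl
  have haem : AEMeasurable (fun ω => ENNReal.ofReal (Real.exp (l * η ω))) P :=
    hint.1.aemeasurable.ennreal_ofReal
  set ν := P.withDensity fun ω => ENNReal.ofReal (Real.exp (l * η ω)) with hν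
  set μ := P.withDensity fun _ => ENNReal.ofReal (Real.exp (l ^ 2 * σ ^ 2 / 2)) with hμ
  have hset : ∀ B, MeasurableSet[m] B → ν B ≤ μ B := by
    intro B hB
    rw [hν, hμ, withDensity_apply _ (hm B hB), withDensity_apply _ (hm B hB),
      ← ofReal_integral_eq_lintegral_ofReal hint.integrableOn
        (Filter.Eventually.of_forall fun _ => (Real.exp_pos _).le),
      ← ofReal_integral_eq_lintegral_ofReal (integrable_const _).integrableOn
        (Filter.Eventually.of_forall fun _ => (Real.exp_pos _).le)]
    refine ENNReal.ofReal_le_ofReal ?_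
    rw [← setIntegral_condExp hm hint hB]
    exact setIntegral_mono_ae integrable_condExp.integrableOn
      (integrable_const _).integrableOn hle
  have htrim : ν.trim hm ≤ μ.trim hm := by
    refine Measure.le_iff.2 fun B hB => ?_
    rw [trim_measurableSet_eq hm hB, trim_measurableSet_eq hm hB]
    exact hset B hB
  have hZ' : Measurable Z := hZ.mono hm le_rfl
  calc ∫⁻ ω, Z ω * ENNReal.ofReal (Real.exp (l * η ω)) ∂P
      = ∫⁻ ω, Z ω ∂ν := by
        rw [hν, lintegral_withDensity_eq_lintegral_mul₀ haem hZ'.aemeasurable]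
        simp only [Pi.mul_apply, mul_comm]
    _ = ∫⁻ ω, Z ω ∂(ν.trim hm) := (lintegral_trim hm hZ).symm
    _ ≤ ∫⁻ ω, Z ω ∂(μ.trim hm) := lintegral_mono' htrim le_rfl
    _ = ∫⁻ ω, Z ω ∂μ := lintegral_trim hm hZ
    _ = _ := by
        rw [hμ, lintegral_withDensity_eq_lintegral_mul₀ aemeasurable_const hZ'.aemeasurable]
        simp only [Pi.mul_apply, mul_comm]

theorem exists_finite_range_approx {Ω : Type*} [MeasurableSpace Ω] {s : Ω → ℝ} (hs : Measurable s)
    {r : ℝ} (hr : 0 ≤ r) :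
    ∃ q : ℕ → Ω → ℝ, (∀ n, Measurable (q n)) ∧ (∀ n, (Set.range (q n)).Finite) ∧
      (∀ n ω, |q n ω| ≤ r) ∧
      ∀ ω, |s ω| ≤ r → Filter.Tendsto (fun n => q n ω) Filter.atTop (nhds (s ω)) := by
  have h0 : (0 : ℝ) ∈ Set.Icc (-r) r := ⟨by linarith, hr⟩
  exact ⟨fun n => SimpleFunc.approxOn s hs (Set.Icc (-r) r) 0 h0 n, fun n => SimpleFunc.measurable _,
    fun n => SimpleFunc.finite_range _,
    fun n ω => abs_le.2 (SimpleFunc.approxOn_mem hs h0 n ω),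
    fun ω hω => SimpleFunc.tendsto_approxOn hs h0 (subset_closure (abs_le.1 hω))⟩

/-- The constant parameter of the moment generating function may be replaced by
an `m`-measurable one: sum over the values of simple functions, then apply Fatou's lemma. -/
theorem CondSubExponential.lintegral_mul_exp_sub_le {Ω : Type*} {m mΩ : MeasurableSpace Ω}
    {P : Measure Ω} [IsFiniteMeasure P] (hm : m ≤ mΩ) {η : Ω → ℝ}
    (hη : Measurable η) {σ b : ℝ} (hb : 0 < b) (h : CondSubExponential P m η σ b)
    {s : Ω → ℝ} (hs : Measurable[m] s) (hsb : ∀ᵐ ω ∂P, |s ω| ≤ 1 / b) {Z : Ω → ℝ≥0∞}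
    (hZ : Measurable[m] Z) :
    ∫⁻ ω, Z ω * ENNReal.ofReal (Real.exp (s ω * η ω - s ω ^ 2 * σ ^ 2 / 2)) ∂P ≤
      ∫⁻ ω, Z ω ∂P := by
  obtain ⟨q, hqm, hqfin, hqI, hqs⟩ := @exists_finite_range_approx Ω m s hs (1 / b) (by positivity)
  have hqlim : ∀ᵐ ω ∂P, Filter.Tendsto (fun n => q n ω) Filter.atTop (nhds (s ω)) := by
    filter_upwards [hsb] with ω hω using hqs ω hω
  have hZ' : Measurable Z := hZ.mono hm le_rfl
  have hsimple : ∀ n,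
      ∫⁻ ω, Z ω * ENNReal.ofReal (Real.exp (q n ω * η ω - q n ω ^ 2 * σ ^ 2 / 2)) ∂P ≤
        ∫⁻ ω, Z ω ∂P := by
    intro n
    have hfib : ∀ v, MeasurableSet[m] (q n ⁻¹' {v}) := fun v =>
      hqm n (measurableSet_singleton v)
    have hsplit : ∀ ω (u : ℝ≥0∞),
        u = ∑ v ∈ (hqfin n).toFinset, (q n ⁻¹' {v}).indicator (fun _ => u) ω := by
      intro ω u
      rw [Finset.sum_eq_single (q n ω)]
      · simp
      · intro v _ hv
        exact Set.indicator_of_notMem (fun hmem => hv (by simpa using hmem.symm)) _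
      · intro hmem
        exact absurd (by simp) hmem
    calc ∫⁻ ω, Z ω * ENNReal.ofReal (Real.exp (q n ω * η ω - q n ω ^ 2 * σ ^ 2 / 2)) ∂P
        = ∫⁻ ω, ∑ v ∈ (hqfin n).toFinset,
            ((q n ⁻¹' {v}).indicator Z ω * ENNReal.ofReal (Real.exp (-(v ^ 2 * σ ^ 2 / 2)))) *
              ENNReal.ofReal (Real.exp (v * η ω)) ∂P := by
          refine lintegral_congr fun ω => ?_
          rw [hsplit ω (Z ω * _)]
          refine Finset.sum_congr rfl fun v _ => ?_
          by_cases hv : ω ∈ q n ⁻¹' {v}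
          · rw [Set.indicator_of_mem hv, Set.indicator_of_mem hv, mul_assoc,
              ← ENNReal.ofReal_mul (Real.exp_pos _).le, ← Real.exp_add]
            have : q n ω = v := hv
            rw [this]
            congr 3
            ring
          · rw [Set.indicator_of_notMem hv, Set.indicator_of_notMem hv]
            simp
      _ = ∑ v ∈ (hqfin n).toFinset, ∫⁻ ω,
            ((q n ⁻¹' {v}).indicator Z ω * ENNReal.ofReal (Real.exp (-(v ^ 2 * σ ^ 2 / 2)))) *
              ENNReal.ofReal (Real.exp (v * η ω)) ∂P := by
          refine lintegral_finsetSum _ fun v _ => ?_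
          have := hZ'.indicator (hm _ (hfib v))
          fun_prop
      _ ≤ ∑ v ∈ (hqfin n).toFinset, ∫⁻ ω,
            ((q n ⁻¹' {v}).indicator Z ω * ENNReal.ofReal (Real.exp (-(v ^ 2 * σ ^ 2 / 2)))) *
              ENNReal.ofReal (Real.exp (v ^ 2 * σ ^ 2 / 2)) ∂P := by
          refine Finset.sum_le_sum fun v hv => ?_
          obtain ⟨ω, rfl⟩ := (hqfin n).mem_toFinset.1 hv
          exact h.lintegral_mul_exp_le hm (hqI n ω)
            ((hZ.indicator (hfib _)).mul_const _)
      _ = ∑ v ∈ (hqfin n).toFinset, ∫⁻ ω, (q n ⁻¹' {v}).indicator Z ω ∂P := by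
          refine Finset.sum_congr rfl fun v _ => lintegral_congr fun ω => ?_
          rw [mul_assoc, ← ENNReal.ofReal_mul (Real.exp_pos _).le, ← Real.exp_add]
          simp
      _ = ∫⁻ ω, Z ω ∂P := by
          rw [← lintegral_finsetSum _ fun v _ => hZ'.indicator (hm _ (hfib v))]
          refine lintegral_congr fun ω => ?_
          conv_rhs => rw [hsplit ω (Z ω)]
          refine Finset.sum_congr rfl fun v _ => ?_
          by_cases hv : ω ∈ q n ⁻¹' {v}
          · rw [Set.indicator_of_mem hv, Set.indicator_of_mem hv]
          · rw [Set.indicator_of_notMem hv, Set.indicator_of_notMem hv]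
  calc ∫⁻ ω, Z ω * ENNReal.ofReal (Real.exp (s ω * η ω - s ω ^ 2 * σ ^ 2 / 2)) ∂P
      ≤ ∫⁻ ω, Filter.liminf (fun n =>
          Z ω * ENNReal.ofReal (Real.exp (q n ω * η ω - q n ω ^ 2 * σ ^ 2 / 2)))
            Filter.atTop ∂P := by
        refine lintegral_mono_ae ?_
        filter_upwards [hqlim] with ω hω
        refine le_of_eq (Filter.Tendsto.liminf_eq ?_).symm
        refine ENNReal.Tendsto.const_mul ?_ (Or.inl (ENNReal.ofReal_pos.2 (Real.exp_pos _)).ne')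
        refine ENNReal.tendsto_ofReal ((Real.continuous_exp.tendsto _).comp ?_)
        exact (hω.mul_const _).sub (((hω.pow 2).mul_const _).div_const _)
    _ ≤ Filter.liminf (fun n => ∫⁻ ω,
          Z ω * ENNReal.ofReal (Real.exp (q n ω * η ω - q n ω ^ 2 * σ ^ 2 / 2)) ∂P)
            Filter.atTop := by
        refine lintegral_liminf_le fun n => ?_
        have : Measurable (q n) := (hqm n).mono hm le_rfl
        fun_prop
    _ ≤ ∫⁻ ω, Z ω ∂P := by
        refine (Filter.liminf_le_liminf (Filter.Eventually.of_forall hsimple)).trans ?_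
        simp

/-- The exponential supermartingale of a predictable sequence `s`: its expectation is at most
one at every time. -/
theorem lintegral_exp_sum_le_one {Ω : Type*} {mΩ : MeasurableSpace Ω} {P : Measure Ω}
    [IsProbabilityMeasure P] {G : ℕ → MeasurableSpace Ω} {σ b : ℝ} (hb : 0 < b)
    {η s : ℕ → Ω → ℝ} (n : ℕ) (hG : ∀ i < n, G i ≤ mΩ)
    (hηG : ∀ i < n, ∀ k < i, Measurable[G i] (η k))
    (hsG : ∀ i < n, ∀ k ≤ i, Measurable[G i] (s k))
    (hη : ∀ i < n, Measurable (η i)) (hnoise : ∀ i < n, CondSubExponential P (G i) (η i) σ b)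
    (hsb : ∀ i < n, ∀ᵐ ω ∂P, |s i ω| ≤ 1 / b) :
    ∫⁻ ω, ENNReal.ofReal (Real.exp
      (∑ i ∈ Finset.range n, (s i ω * η i ω - s i ω ^ 2 * σ ^ 2 / 2))) ∂P ≤ 1 := by
  induction n with
  | zero => simp
  | succ n ih =>
    refine le_trans ?_ (ih (fun i hi => hG i (hi.trans n.lt_succ_self))
      (fun i hi => hηG i (hi.trans n.lt_succ_self)) (fun i hi => hsG i (hi.trans n.lt_succ_self))
      (fun i hi => hη i (hi.trans n.lt_succ_self)) (fun i hi => hnoise i (hi.trans n.lt_succ_self))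
      (fun i hi => hsb i (hi.trans n.lt_succ_self)))
    simp only [Finset.sum_range_succ, Real.exp_add, ENNReal.ofReal_mul (Real.exp_pos _).le]
    refine (hnoise n n.lt_succ_self).lintegral_mul_exp_sub_le (hG n n.lt_succ_self)
      (hη n n.lt_succ_self) hb (hsG n n.lt_succ_self n le_rfl) (hsb n n.lt_succ_self) ?_
    refine (Real.measurable_exp.comp (Finset.measurable_sum _ fun k hk => ?_)).ennreal_ofReal
    have hk := Finset.mem_range.1 hk
    have h1 := hηG n n.lt_succ_self k hk
    have h2 := hsG n n.lt_succ_self k hk.le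
    exact (h2.mul h1).sub (((h2.pow_const 2).mul_const _).div_const _)

/-! ### The confidence ball -/

/-- The function `f` lies outside the closed ball of squared radius `B`, in the empirical `L²`
distance of the first `t` actions `x i`, around some least squares fit `c j` of the rewards `r i`
among the centres `c`. Quantifying over all least squares fits avoids choosing one. -/
def IsFarFromFit {A : Type*} {N : ℕ} (c : Fin N → A → ℝ) (B : ℝ) (x : ℕ → A) (r : ℕ → ℝ) (t : ℕ)
    (f : A → ℝ) : Prop :=
  ∃ j, (∀ k, ∑ i ∈ Finset.range t, (c j (x i) - r i) ^ 2 ≤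
      ∑ i ∈ Finset.range t, (c k (x i) - r i) ^ 2) ∧
    B < ∑ i ∈ Finset.range t, (f (x i) - c j (x i)) ^ 2

theorem sum_sq_sub_le_of_not_isFarFromFit {A : Type*} {N : ℕ} (hN : 0 < N) {c : Fin N → A → ℝ}
    {B : ℝ} {x : ℕ → A} {r : ℕ → ℝ} {t : ℕ} {f g : A → ℝ} (hf : ¬ IsFarFromFit c B x r t f)
    (hg : ¬ IsFarFromFit c B x r t g) :
    ∑ i ∈ Finset.range t, (f (x i) - g (x i)) ^ 2 ≤ 4 * B := by
  have : Nonempty (Fin N) := ⟨⟨0, hN⟩⟩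
  obtain ⟨j, hj⟩ := Finite.exists_min fun j => ∑ i ∈ Finset.range t, (c j (x i) - r i) ^ 2
  have h1 : ∑ i ∈ Finset.range t, (f (x i) - c j (x i)) ^ 2 ≤ B :=
    not_lt.1 fun h => hf ⟨j, hj, h⟩
  have h2 : ∑ i ∈ Finset.range t, (g (x i) - c j (x i)) ^ 2 ≤ B :=
    not_lt.1 fun h => hg ⟨j, hj, h⟩
  calc ∑ i ∈ Finset.range t, (f (x i) - g (x i)) ^ 2
      ≤ ∑ i ∈ Finset.range t,
          (2 * (f (x i) - c j (x i)) ^ 2 + 2 * (g (x i) - c j (x i)) ^ 2) :=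
        Finset.sum_le_sum fun i _ => by
          nlinarith [sq_nonneg (f (x i) - c j (x i) + (g (x i) - c j (x i)))]
    _ = 2 * ∑ i ∈ Finset.range t, (f (x i) - c j (x i)) ^ 2
          + 2 * ∑ i ∈ Finset.range t, (g (x i) - c j (x i)) ^ 2 := by
        rw [Finset.sum_add_distrib, Finset.mul_sum, Finset.mul_sum]
    _ ≤ 4 * B := by linarith

theorem measurableSet_isFarFromFit {A H : Type*} [MeasurableSpace A] [MeasurableSpace H]
    {F : Set (A → ℝ)} [MeasurableSpace F] (heval : Measurable fun p : F × A => (p.1 : A → ℝ) p.2)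
    {N : ℕ} {c : Fin N → A → ℝ} (hc : ∀ j, Measurable (c j)) (B : ℝ) {x : ℕ → H → A}
    {r : ℕ → H → ℝ} {t : ℕ} (hx : ∀ i < t, Measurable (x i)) (hr : ∀ i < t, Measurable (r i)) :
    MeasurableSet {p : H × F | IsFarFromFit c B (fun i => x i p.1) (fun i => r i p.1) t p.2} := by
  have hfit : ∀ j, Measurable fun p : H × F =>
      ∑ i ∈ Finset.range t, (c j (x i p.1) - r i p.1) ^ 2 := fun j =>
    Finset.measurable_sum _ fun i hi => ((((hc j).comp (hx i (Finset.mem_range.1 hi))).comp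
      measurable_fst).sub ((hr i (Finset.mem_range.1 hi)).comp measurable_fst)).pow_const 2
  have hdist : ∀ j, Measurable fun p : H × F =>
      ∑ i ∈ Finset.range t, ((p.2 : A → ℝ) (x i p.1) - c j (x i p.1)) ^ 2 := fun j =>
    Finset.measurable_sum _ fun i hi => by
      have h1 : Measurable fun p : H × F => x i p.1 :=
        (hx i (Finset.mem_range.1 hi)).comp measurable_fst
      exact ((heval.comp (measurable_snd.prodMk h1)).sub ((hc j).comp h1)).pow_const 2
  have : {p : H × F | IsFarFromFit c B (fun i => x i p.1) (fun i => r i p.1) t p.2} =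
      ⋃ j, (⋂ k, {p : H × F | ∑ i ∈ Finset.range t, (c j (x i p.1) - r i p.1) ^ 2 ≤
        ∑ i ∈ Finset.range t, (c k (x i p.1) - r i p.1) ^ 2}) ∩
        {p : H × F | B < ∑ i ∈ Finset.range t, ((p.2 : A → ℝ) (x i p.1) - c j (x i p.1)) ^ 2} := by
    ext p
    simp [IsFarFromFit]
  rw [this]
  exact MeasurableSet.iUnion fun j => (MeasurableSet.iInter fun k =>
    measurableSet_le (hfit j) (hfit k)).inter (measurableSet_lt measurable_const (hdist j))

/-- If the function with deviations `x` fits the rewards at least as well as the one with deviations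
`y`, of size at most `3 α`, then it is close to the truth unless the noise has a large
correlation with the difference `x - y`, which is bounded by `C`. -/
theorem le_exponent_of_fit_le {C α σ r B L : ℝ} (hα : 0 < α) (hr : 0 < r) (hC : 0 < C)
    (hu : 0 ≤ 1 - 2 * r * σ ^ 2) {t T : ℕ} (htT : t ≤ T)
    (hB : L / r + 3 * (1 + 2 * r * σ ^ 2) * C * α * T ≤ (1 - 2 * r * σ ^ 2) * B)
    {x y η : ℕ → ℝ} (hy : ∀ i, |y i| ≤ C) (hyα : ∀ i, |y i| ≤ 3 * α)
    (hxy : ∀ i, |x i - y i| ≤ C)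
    (hfit : ∑ i ∈ Finset.range t, (x i - η i) ^ 2 ≤ ∑ i ∈ Finset.range t, (y i - η i) ^ 2)
    (hfar : B < ∑ i ∈ Finset.range t, x i ^ 2) :
    L ≤ ∑ i ∈ Finset.range t,
      (2 * r * (x i - y i) * η i - (2 * r * (x i - y i)) ^ 2 * σ ^ 2 / 2) := by
  have hu0 : 0 ≤ r * σ ^ 2 := by positivity
  have hterm : ∀ i, r * ((1 - 2 * r * σ ^ 2) * x i ^ 2 - 3 * (1 + 2 * r * σ ^ 2) * C * α)
      + r * ((y i - η i) ^ 2 - (x i - η i) ^ 2) ≤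
      2 * r * (x i - y i) * η i - (2 * r * (x i - y i)) ^ 2 * σ ^ 2 / 2 := by
    intro i
    have h1 : y i ^ 2 ≤ 3 * C * α := by
      rw [← sq_abs]
      nlinarith [hy i, hyα i, abs_nonneg (y i)]
    have h2 : -(y i * (x i - y i)) ≤ 3 * C * α := by
      refine (neg_le_abs _).trans ?_
      rw [abs_mul]
      nlinarith [hxy i, hyα i, abs_nonneg (y i), abs_nonneg (x i - y i)]
    have h3 : (1 - 2 * r * σ ^ 2) * x i ^ 2 - 3 * (1 + 2 * r * σ ^ 2) * C * α
        + y i ^ 2 - x i ^ 2 + 2 * (r * σ ^ 2) * (x i - y i) ^ 2 ≤ 0 := by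
      nlinarith [mul_nonneg hu (sub_nonneg.2 h1), mul_nonneg hu0 (sub_nonneg.2 h2)]
    nlinarith [mul_nonneg hr.le (neg_nonneg.2 h3)]
  refine le_trans ?_ (Finset.sum_le_sum fun i _ => hterm i)
  rw [Finset.sum_add_distrib, ← Finset.mul_sum, ← Finset.mul_sum, Finset.sum_sub_distrib,
    Finset.sum_sub_distrib, ← Finset.mul_sum, Finset.sum_const, Finset.card_range, nsmul_eq_mul]
  have h4 : (t : ℝ) * (3 * (1 + 2 * r * σ ^ 2) * C * α) ≤ 3 * (1 + 2 * r * σ ^ 2) * C * α * T := by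
    rw [mul_comm]
    gcongr
  have h5 := mul_le_mul_of_nonneg_left hfar.le hu
  have h6 : L / r ≤ (1 - 2 * r * σ ^ 2) * ∑ i ∈ Finset.range t, x i ^ 2
      - (t : ℝ) * (3 * (1 + 2 * r * σ ^ 2) * C * α) := by linarith
  rw [div_le_iff₀ hr] at h6
  nlinarith [mul_nonneg hr.le (sub_nonneg.2 hfit)]

theorem measurable_action_history {Ω A : Type*} [MeasurableSpace A] (a : ℕ → Ω → A)
    (R : ℕ → Ω → ℝ) {t i : ℕ} (hi : i < t) : Measurable[history a R t] (a i) := by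
  refine Measurable.mono (comap_measurable (a i)) ?_ le_rfl
  exact le_sup_left.trans (le_iSup₂ (f := fun (i : ℕ) (_ : i ∈ Finset.range t) =>
    (MeasurableSpace.comap (a i) inferInstance ⊔ MeasurableSpace.comap (R i) inferInstance))
    i (Finset.mem_range.2 hi))

theorem measurable_reward_history {Ω A : Type*} [MeasurableSpace A] (a : ℕ → Ω → A)
    (R : ℕ → Ω → ℝ) {t i : ℕ} (hi : i < t) : Measurable[history a R t] (R i) := by
  refine Measurable.mono (comap_measurable (R i)) ?_ le_rfl
  exact le_sup_right.trans (le_iSup₂ (f := fun (i : ℕ) (_ : i ∈ Finset.range t) =>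
    (MeasurableSpace.comap (a i) inferInstance ⊔ MeasurableSpace.comap (R i) inferInstance))
    i (Finset.mem_range.2 hi))

theorem history_le {Ω A : Type*} [mΩ : MeasurableSpace Ω] [MeasurableSpace A] {a : ℕ → Ω → A}
    {R : ℕ → Ω → ℝ} {t : ℕ} (ha : ∀ i < t, Measurable (a i)) (hR : ∀ i < t, Measurable (R i)) :
    history a R t ≤ mΩ :=
  iSup₂_le fun i hi => sup_le (ha i (Finset.mem_range.1 hi)).comap_le
    (hR i (Finset.mem_range.1 hi)).comap_le

/-- In every round the true function is in the confidence ball with probability `≥ 1 - δ`. -/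
theorem measure_isFarFromFit_le {Ω A : Type*} [mΩ : MeasurableSpace Ω] [MeasurableSpace A]
    {P : Measure Ω} [IsProbabilityMeasure P] {F : Set (A → ℝ)} [MeasurableSpace F] {p₀ : Measure F}
    {C σ b : ℝ} (hC : 0 < C) (hb : 0 < b) (hF : ∀ f ∈ F, ∀ x : A, f x ∈ Set.Icc 0 C)
    (heval : Measurable fun p : F × A => (p.1 : A → ℝ) p.2) {T : ℕ} {f₀ : Ω → F} {a : ℕ → Ω → A}
    {R : ℕ → Ω → ℝ} (hmodel : IsBanditModel P p₀ σ b T f₀ a R) {α δ r B : ℝ} (hα : 0 < α)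
    (hδ : 0 < δ) {N : ℕ} (hN : 0 < N) {c : Fin N → A → ℝ} (hcF : ∀ j, c j ∈ F)
    (hc : ∀ f ∈ F, ∃ j, ∀ x, |f x - c j x| ≤ α) (hr : 0 < r) (hrb : 2 * r * C ≤ 1 / b)
    (hu : 0 ≤ 1 - 2 * r * σ ^ 2)
    (hB : Real.log (N / δ) / r + 3 * (1 + 2 * r * σ ^ 2) * C * α * T ≤ (1 - 2 * r * σ ^ 2) * B)
    {t : ℕ} (ht : t ≤ T) :
    P {ω | IsFarFromFit c B (fun i => a i ω) (fun i => R i ω) t (f₀ ω)} ≤ ENNReal.ofReal δ := by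
  have hsec : ∀ x : A, Measurable fun f : F => (f : A → ℝ) x := fun x =>
    heval.comp (measurable_id.prodMk measurable_const)
  have hcm : ∀ j, Measurable (c j) := fun j =>
    heval.comp ((measurable_const (a := (⟨c j, hcF j⟩ : F))).prodMk measurable_id)
  have hp₀ : IsProbabilityMeasure p₀ := by
    rw [← hmodel.law_f₀]
    exact Measure.isProbabilityMeasure_map hmodel.measurable_f₀.aemeasurable
  obtain ⟨J, hJm, hJ⟩ := exists_measurable_near hsec p₀ hc
  have hJω : ∀ᵐ ω ∂P, ∀ x, |(f₀ ω : A → ℝ) x - c (J (f₀ ω)) x| ≤ 3 * α := by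
    rw [← hmodel.law_f₀] at hJ
    exact ae_of_ae_map hmodel.measurable_f₀.aemeasurable hJ
  set G : ℕ → MeasurableSpace Ω := fun i => MeasurableSpace.comap f₀ inferInstance ⊔
    history a R i ⊔ MeasurableSpace.comap (a i) inferInstance with hG
  have hGle : ∀ i < t, G i ≤ mΩ := fun i hi => sup_le (sup_le hmodel.measurable_f₀.comap_le
    (history_le (fun k hk => hmodel.measurable_action k (by omega))
      fun k hk => hmodel.measurable_reward k (by omega)))
    (hmodel.measurable_action i (by omega)).comap_le
  have hf₀G : ∀ i, Measurable[G i] f₀ := fun i =>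
    (comap_measurable f₀).mono (le_sup_left.trans le_sup_left) le_rfl
  have haG : ∀ i, ∀ k ≤ i, Measurable[G i] (a k) := by
    intro i k hk
    rcases hk.lt_or_eq with hk | rfl
    · exact (measurable_action_history a R hk).mono (le_sup_right.trans le_sup_left) le_rfl
    · exact (comap_measurable (a k)).mono le_sup_right le_rfl
  have hRG : ∀ i, ∀ k < i, Measurable[G i] (R k) := fun i k hk =>
    (measurable_reward_history a R hk).mono (le_sup_right.trans le_sup_left) le_rfl
  have hcJ : Measurable fun p : Fin N × A => c p.1 p.2 :=
    measurable_from_prod_countable_right hcm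
  set η : ℕ → Ω → ℝ := fun i ω => R i ω - (f₀ ω : A → ℝ) (a i ω) with hη
  have hfit : ∀ j, P {ω | (∀ k, ∑ i ∈ Finset.range t, (c j (a i ω) - R i ω) ^ 2 ≤
      ∑ i ∈ Finset.range t, (c k (a i ω) - R i ω) ^ 2) ∧
      B < ∑ i ∈ Finset.range t, ((f₀ ω : A → ℝ) (a i ω) - c j (a i ω)) ^ 2} ≤
      ENNReal.ofReal (δ / N) := by
    intro j
    set s : ℕ → Ω → ℝ := fun i ω => 2 * r * (c j (a i ω) - c (J (f₀ ω)) (a i ω)) with hs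
    have hdiff : ∀ f ∈ F, ∀ g ∈ F, ∀ x, |f x - g x| ≤ C := fun f hf g hg x => by
      have h1 := hF f hf x
      have h2 := hF g hg x
      exact abs_le.2 ⟨by linarith [h1.1, h2.2], by linarith [h1.2, h2.1]⟩
    have hexp := lintegral_exp_sum_le_one (P := P) (G := G) (η := η) (s := s) (σ := σ) hb t hGle
      (fun i _ k hk => (hRG i k hk).sub (heval.comp ((hf₀G i).prodMk (haG i k hk.le))))
      (fun i _ k hk => (((hcm j).comp (haG i k hk)).sub
        (hcJ.comp ((hJm.comp (hf₀G i)).prodMk (haG i k hk)))).const_mul _)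
      (fun i hi => (hmodel.measurable_reward i (by omega)).sub (heval.comp
        (hmodel.measurable_f₀.prodMk (hmodel.measurable_action i (by omega)))))
      (fun i hi => hmodel.noise i (by omega))
      (fun i _ => Filter.Eventually.of_forall fun ω => by
        rw [hs, abs_mul, abs_of_pos (by positivity : 0 < 2 * r)]
        exact (mul_le_mul_of_nonneg_left (hdiff _ (hcF _) _ (hcF _) _) (by positivity)).trans hrb)
    set X : Ω → ℝ := fun ω =>
      ∑ i ∈ Finset.range t, (s i ω * η i ω - s i ω ^ 2 * σ ^ 2 / 2) with hX
    have hsm : ∀ i < t, Measurable (s i) := fun i hi =>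
      (((hcm j).comp (haG i i le_rfl)).sub
        (hcJ.comp ((hJm.comp (hf₀G i)).prodMk (haG i i le_rfl)))).const_mul _ |>.mono
          (hGle i hi) le_rfl
    have hηm : ∀ i < t, Measurable (η i) := fun i hi =>
      (hmodel.measurable_reward i (by omega)).sub (heval.comp
        (hmodel.measurable_f₀.prodMk (hmodel.measurable_action i (by omega))))
    have hXm : Measurable X := Finset.measurable_sum _ fun i hi => by
      have h1 := hsm i (Finset.mem_range.1 hi)
      have h2 := hηm i (Finset.mem_range.1 hi)
      fun_prop
    have hNδ : (0 : ℝ) < N / δ := by positivity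
    have hsub : P {ω | (∀ k, ∑ i ∈ Finset.range t, (c j (a i ω) - R i ω) ^ 2 ≤
        ∑ i ∈ Finset.range t, (c k (a i ω) - R i ω) ^ 2) ∧
        B < ∑ i ∈ Finset.range t, ((f₀ ω : A → ℝ) (a i ω) - c j (a i ω)) ^ 2} ≤
        P {ω | ENNReal.ofReal (N / δ) ≤ ENNReal.ofReal (Real.exp (X ω))} := by
      refine measure_mono_ae ?_
      filter_upwards [hJω] with ω hω hmem
      obtain ⟨h1, h2⟩ := hmem
      refine ENNReal.ofReal_le_ofReal ?_
      rw [← Real.log_le_iff_le_exp hNδ]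
      have hkey := le_exponent_of_fit_le (x := fun i => c j (a i ω) - (f₀ ω : A → ℝ) (a i ω))
        (y := fun i => c (J (f₀ ω)) (a i ω) - (f₀ ω : A → ℝ) (a i ω)) (η := fun i => η i ω)
        hα hr hC hu ht hB (fun i => hdiff _ (hcF _) _ (f₀ ω).2 _)
        (fun i => by rw [abs_sub_comm]; exact hω _)
        (fun i => by
          rw [sub_sub_sub_cancel_right]
          exact hdiff _ (hcF _) _ (hcF _) _)
        (by
          simp only [hη, sub_sub, add_sub_cancel]
          exact h1 _)
        (by
          refine h2.trans_eq (Finset.sum_congr rfl fun i _ => ?_)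
          ring)
      simpa only [sub_sub_sub_cancel_right] using hkey
    refine hsub.trans ?_
    have hmarkov := mul_meas_ge_le_lintegral (μ := P)
      (Real.measurable_exp.comp hXm).ennreal_ofReal (ENNReal.ofReal (N / δ))
    have h3 : ENNReal.ofReal (δ / N) = (ENNReal.ofReal (N / δ))⁻¹ := by
      rw [← ENNReal.ofReal_inv_of_pos hNδ, inv_div]
    rw [h3, ENNReal.le_inv_iff_mul_le, mul_comm]
    exact hmarkov.trans hexp
  have hunion : {ω | IsFarFromFit c B (fun i => a i ω) (fun i => R i ω) t (f₀ ω)} =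
      ⋃ j, {ω | (∀ k, ∑ i ∈ Finset.range t, (c j (a i ω) - R i ω) ^ 2 ≤
      ∑ i ∈ Finset.range t, (c k (a i ω) - R i ω) ^ 2) ∧
      B < ∑ i ∈ Finset.range t, ((f₀ ω : A → ℝ) (a i ω) - c j (a i ω)) ^ 2} := by
    ext ω
    simp [IsFarFromFit]
  rw [hunion]
  refine (measure_iUnion_le _).trans ?_
  rw [tsum_fintype]
  refine (Finset.sum_le_sum fun j _ => hfit j).trans ?_
  rw [Finset.sum_const, Finset.card_univ, Fintype.card_fin, nsmul_eq_mul,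
    ← ENNReal.ofReal_natCast, ← ENNReal.ofReal_mul (Nat.cast_nonneg _)]
  have : (N : ℝ) * (δ / N) = δ := by field_simp
  rw [this]

/-! ### Posterior sampling -/

/-- Probability matching: `X` and a posterior sample `Y` have the same joint law with any
variable `h` measurable with respect to the conditioning σ-algebra `m`. -/
theorem measure_prodMk_mem_eq_of_condExp_eq {Ω H E : Type*} {m m' mΩ : MeasurableSpace Ω}
    [MeasurableSpace H] [MeasurableSpace E] {P : Measure Ω} [IsFiniteMeasure P] (hm : m ≤ m')
    (hm' : m' ≤ mΩ) {X Y : Ω → E} (hX : Measurable X) (hY : Measurable Y)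
    (h : ∀ S, MeasurableSet S → P⟦Y ⁻¹' S | m'⟧ =ᵐ[P] P⟦X ⁻¹' S | m⟧) {g : Ω → H}
    (hg : Measurable[m] g) {D : Set (H × E)} (hD : MeasurableSet D) :
    P {ω | (g ω, Y ω) ∈ D} = P {ω | (g ω, X ω) ∈ D} := by
  have hgΩ : Measurable g := hg.mono (hm.trans hm') le_rfl
  suffices hmap : P.map (fun ω => (g ω, Y ω)) = P.map (fun ω => (g ω, X ω)) by
    have := congrArg (· D) hmap
    rwa [Measure.map_apply (hgΩ.prodMk hY) hD, Measure.map_apply (hgΩ.prodMk hX) hD] at this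
  refine Measure.ext_prod fun {S U} hS hU => ?_
  rw [Measure.map_apply (hgΩ.prodMk hY) (hS.prod hU),
    Measure.map_apply (hgΩ.prodMk hX) (hS.prod hU)]
  have hreal : ∀ {Z : Ω → E}, Measurable Z →
      ∫ ω in g ⁻¹' S, (Z ⁻¹' U).indicator (fun _ => (1 : ℝ)) ω ∂P =
        P.real ((fun ω => (g ω, Z ω)) ⁻¹' S ×ˢ U) := by
    intro Z hZ
    rw [setIntegral_indicator (hZ hU), setIntegral_const, smul_eq_mul, mul_one]
    rfl
  have hint : ∀ {Z : Ω → E}, Measurable Z →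
      Integrable ((Z ⁻¹' U).indicator fun _ => (1 : ℝ)) P := fun hZ =>
    (integrable_const _).indicator (hZ hU)
  rw [← measureReal_eq_measureReal_iff, ← hreal hX, ← hreal hY,
    ← setIntegral_condExp hm' (hint hY) (hm _ (hg hS)),
    ← setIntegral_condExp (hm.trans hm') (hint hX) (hg hS)]
  exact integral_congr_ae (ae_restrict_of_ae (h U hU))

theorem IsThompsonSampling.measure_mem_eq {Ω A : Type*} [MeasurableSpace Ω] [MeasurableSpace A]
    {P : Measure Ω} [IsProbabilityMeasure P] {F : Set (A → ℝ)} [MeasurableSpace F]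
    {p₀ : Measure F} {σ b : ℝ} {T : ℕ} {f₀ : Ω → F} {f' : ℕ → Ω → F} {a : ℕ → Ω → A}
    {R : ℕ → Ω → ℝ} (hmodel : IsBanditModel P p₀ σ b T f₀ a R)
    (hTS : IsThompsonSampling P T f₀ f' a R) {t : ℕ} (ht : t < T) {E : Set (Ω × F)}
    (hE : MeasurableSet[(history a R t).prod inferInstance] E) :
    P {ω | (ω, f' t ω) ∈ E} = P {ω | (ω, f₀ ω) ∈ E} := by
  have hhist := history_le (t := t) (fun i hi => hmodel.measurable_action i (hi.trans ht))
    fun i hi => hmodel.measurable_reward i (hi.trans ht)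
  exact @measure_prodMk_mem_eq_of_condExp_eq Ω Ω F (history a R t) _ _ (history a R t) _ P _
    le_sup_right (sup_le hmodel.measurable_f₀.comap_le hhist) f₀ (f' t) hmodel.measurable_f₀
    (hTS.measurable_sample t ht) (hTS.posterior t ht) id (@measurable_id Ω (history a R t)) E hE

theorem IsThompsonSampling.map_sample_eq {Ω A : Type*} [MeasurableSpace Ω] [MeasurableSpace A]
    {P : Measure Ω} [IsProbabilityMeasure P] {F : Set (A → ℝ)} [MeasurableSpace F]
    {p₀ : Measure F} {σ b : ℝ} {T : ℕ} {f₀ : Ω → F} {f' : ℕ → Ω → F} {a : ℕ → Ω → A}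
    {R : ℕ → Ω → ℝ} (hmodel : IsBanditModel P p₀ σ b T f₀ a R)
    (hTS : IsThompsonSampling P T f₀ f' a R) {t : ℕ} (ht : t < T) : P.map (f' t) = p₀ := by
  rw [← hmodel.law_f₀]
  ext S hS
  rw [Measure.map_apply (hTS.measurable_sample t ht) hS,
    Measure.map_apply hmodel.measurable_f₀ hS]
  exact hTS.measure_mem_eq hmodel ht (E := Prod.snd ⁻¹' S)
    (@measurable_snd Ω F (history a R t) _ S hS)

/-! ### Regret -/

theorem integrable_eval {Ω A : Type*} [MeasurableSpace Ω] [MeasurableSpace A] {P : Measure Ω}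
    [IsFiniteMeasure P] {F : Set (A → ℝ)} [MeasurableSpace F] {C : ℝ}
    (hF : ∀ f ∈ F, ∀ x : A, f x ∈ Set.Icc 0 C)
    (heval : Measurable fun p : F × A => (p.1 : A → ℝ) p.2) {g : Ω → F} (hg : Measurable g)
    {x : Ω → A} (hx : Measurable x) : Integrable (fun ω => (g ω : A → ℝ) (x ω)) P :=
  Integrable.of_mem_Icc 0 C (heval.comp (hg.prodMk hx)).aemeasurable
    (Filter.Eventually.of_forall fun ω => hF (g ω) (g ω).2 (x ω))

/-- Since the sampled function has the law of the true one and attains its maximum at the action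
played, the regret is the expected excess of the sampled functions over the true one. -/
theorem bayesRegret_eq {Ω A : Type*} [MeasurableSpace Ω] [MeasurableSpace A]
    {P : Measure Ω} [IsProbabilityMeasure P] {F : Set (A → ℝ)} [MeasurableSpace F]
    {p₀ : Measure F} {C σ b : ℝ} (hC : 0 < C) (hF : ∀ f ∈ F, ∀ x : A, f x ∈ Set.Icc 0 C)
    (heval : Measurable fun p : F × A => (p.1 : A → ℝ) p.2)
    (hmax : AEMeasurable (fun f : F => ⨆ x : A, (f : A → ℝ) x) p₀)
    {T : ℕ} {f₀ : Ω → F} {f' : ℕ → Ω → F} {a : ℕ → Ω → A}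
    {R : ℕ → Ω → ℝ} (hmodel : IsBanditModel P p₀ σ b T f₀ a R)
    (hTS : IsThompsonSampling P T f₀ f' a R) :
    bayesRegret P T f₀ a = ENNReal.ofReal (∫ ω, ∑ t ∈ Finset.range T,
      ((f' t ω : A → ℝ) (a t ω) - (f₀ ω : A → ℝ) (a t ω)) ∂P) := by
  have hbdd : ∀ f : F, BddAbove (Set.range (f : A → ℝ)) := fun f =>
    ⟨C, by rintro _ ⟨x, rfl⟩; exact (hF f f.2 x).2⟩
  have hsup : ∀ f : F, (⨆ x : A, (f : A → ℝ) x) ∈ Set.Icc 0 C := fun f =>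
    ⟨Real.iSup_nonneg fun x => (hF f f.2 x).1, Real.iSup_le (fun x => (hF f f.2 x).2) hC.le⟩
  have hsupm : AEMeasurable (fun ω => ⨆ x : A, (f₀ ω : A → ℝ) x) P := by
    rw [← hmodel.law_f₀] at hmax
    exact hmax.comp_measurable hmodel.measurable_f₀
  have hint₀ : Integrable (fun ω => ⨆ x : A, (f₀ ω : A → ℝ) x) P :=
    Integrable.of_mem_Icc 0 C hsupm (Filter.Eventually.of_forall fun ω => hsup (f₀ ω))
  have hval : ∀ {g : Ω → F}, Measurable g → ∀ t < T,
      Integrable (fun ω => (g ω : A → ℝ) (a t ω)) P := fun hg t ht =>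
    integrable_eval hF heval hg (hmodel.measurable_action t ht)
  have heq : ∀ t < T, ∫ ω, (⨆ x : A, (f₀ ω : A → ℝ) x) ∂P = ∫ ω, (f' t ω : A → ℝ) (a t ω) ∂P := by
    intro t ht
    have h1 : ∫ ω, (⨆ x : A, (f₀ ω : A → ℝ) x) ∂P = ∫ f : F, (⨆ x : A, (f : A → ℝ) x) ∂p₀ := by
      rw [← hmodel.law_f₀, integral_map hmodel.measurable_f₀.aemeasurable]
      rw [hmodel.law_f₀]
      exact hmax.aestronglyMeasurable
    have h2 : ∫ ω, (⨆ x : A, (f' t ω : A → ℝ) x) ∂P = ∫ f : F, (⨆ x : A, (f : A → ℝ) x) ∂p₀ := by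
      rw [← hTS.map_sample_eq hmodel ht, integral_map (hTS.measurable_sample t ht).aemeasurable]
      rw [hTS.map_sample_eq hmodel ht]
      exact hmax.aestronglyMeasurable
    rw [h1, ← h2]
    refine integral_congr_ae ?_
    filter_upwards [hTS.argmax t ht] with ω hω
    have : Nonempty A := ⟨a t ω⟩
    exact le_antisymm (ciSup_le hω) (le_ciSup (hbdd (f' t ω)) (a t ω))
  unfold bayesRegret
  rw [← ofReal_integral_eq_lintegral_ofReal]
  · congr 1
    rw [integral_finsetSum, integral_finsetSum]
    · refine Finset.sum_congr rfl fun t ht => ?_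
      have ht := Finset.mem_range.1 ht
      rw [integral_sub hint₀ (hval hmodel.measurable_f₀ t ht),
        integral_sub (hval (hTS.measurable_sample t ht) t ht) (hval hmodel.measurable_f₀ t ht),
        heq t ht]
    · intro t ht
      have ht := Finset.mem_range.1 ht
      exact (hval (hTS.measurable_sample t ht) t ht).sub (hval hmodel.measurable_f₀ t ht)
    · intro t ht
      exact hint₀.sub (hval hmodel.measurable_f₀ t (Finset.mem_range.1 ht))
  · exact integrable_finsetSum _ fun t ht =>
      hint₀.sub (hval hmodel.measurable_f₀ t (Finset.mem_range.1 ht))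
  · exact Filter.Eventually.of_forall fun ω => Finset.sum_nonneg fun t _ =>
      sub_nonneg.2 (le_ciSup (hbdd (f₀ ω)) (a t ω))

/-- The regret bound for a finite class of centres and any squared radius `B` that is large enough
for the confidence balls. -/
theorem integral_sum_excess_le {Ω A : Type*} [MeasurableSpace Ω] [MeasurableSpace A]
    {P : Measure Ω} [IsProbabilityMeasure P] {F : Set (A → ℝ)} [MeasurableSpace F]
    {p₀ : Measure F} {C σ b : ℝ} (hC : 0 < C) (hb : 0 < b)
    (hF : ∀ f ∈ F, ∀ x : A, f x ∈ Set.Icc 0 C)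
    (heval : Measurable fun p : F × A => (p.1 : A → ℝ) p.2)
    {T : ℕ} {f₀ : Ω → F} {f' : ℕ → Ω → F} {a : ℕ → Ω → A}
    {R : ℕ → Ω → ℝ} (hmodel : IsBanditModel P p₀ σ b T f₀ a R)
    (hTS : IsThompsonSampling P T f₀ f' a R) {κ : ℝ} (hκ : 0 ≤ κ) {d : ℕ}
    (hd : eluderDim F κ = d) {α δ r B : ℝ} (hα : 0 < α)
    (hδ : 0 < δ) (hδT : 2 * T * δ ≤ 1) {N : ℕ} (hN : 0 < N) {c : Fin N → A → ℝ}
    (hcF : ∀ j, c j ∈ F) (hc : ∀ f ∈ F, ∃ j, ∀ x, |f x - c j x| ≤ α) (hr : 0 < r)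
    (hrb : 2 * r * C ≤ 1 / b) (hu : 0 ≤ 1 - 2 * r * σ ^ 2) (hB0 : 0 ≤ B)
    (hB : Real.log (N / δ) / r + 3 * (1 + 2 * r * σ ^ 2) * C * α * T ≤
      (1 - 2 * r * σ ^ 2) * B) :
    ∫ ω, ∑ t ∈ Finset.range T, ((f' t ω : A → ℝ) (a t ω) - (f₀ ω : A → ℝ) (a t ω)) ∂P ≤
      T * κ + (d + 1) * C + 4 * Real.sqrt (d * B * T) := by
  classical
  have hcm : ∀ j, Measurable (c j) := fun j =>
    heval.comp ((measurable_const (a := (⟨c j, hcF j⟩ : F))).prodMk measurable_id)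
  have hdiff : ∀ f g : F, ∀ x, (f : A → ℝ) x - (g : A → ℝ) x ≤ C := fun f g x => by
    have h1 := hF f f.2 x
    have h2 := hF g g.2 x
    linarith [h1.2, h2.1]
  set Q : ℕ → (Ω → F) → Set Ω := fun t g =>
    {ω | IsFarFromFit c B (fun i => a i ω) (fun i => R i ω) t (g ω)} with hQ
  have hQm : ∀ t < T, ∀ g : Ω → F, Measurable g → MeasurableSet (Q t g) := fun t ht g hg =>
    (measurable_id.prodMk hg) (measurableSet_isFarFromFit heval hcm B
      (fun i hi => hmodel.measurable_action i (hi.trans ht))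
      fun i hi => hmodel.measurable_reward i (hi.trans ht))
  have hQ₀ : ∀ t < T, P.real (Q t f₀) ≤ δ := fun t ht =>
    ENNReal.toReal_le_of_le_ofReal hδ.le
      (measure_isFarFromFit_le hC hb hF heval hmodel hα hδ hN hcF hc hr hrb hu hB ht.le)
  have hQ' : ∀ t < T, P.real (Q t (f' t)) ≤ δ := fun t ht => by
    refine le_trans (le_of_eq ?_) (hQ₀ t ht)
    refine congrArg ENNReal.toReal (hTS.measure_mem_eq hmodel ht
      (E := {p : Ω × F | IsFarFromFit c B (fun i => a i p.1) (fun i => R i p.1) t p.2}) ?_)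
    exact @measurableSet_isFarFromFit A Ω _ (history a R t) F _ heval N c hcm B a R t
      (fun i hi => measurable_action_history a R hi) fun i hi => measurable_reward_history a R hi
  have hind : ∀ t < T, ∀ g : Ω → F, Measurable g →
      Integrable ((Q t g).indicator fun _ => C) P := fun t ht g hg =>
    (integrable_const _).indicator (hQm t ht g hg)
  have hpath : ∀ ω, ∑ t ∈ Finset.range T,
      ((f' t ω : A → ℝ) (a t ω) - (f₀ ω : A → ℝ) (a t ω)) ≤
      (T * κ + d * C + 4 * Real.sqrt (d * B * T)) + ∑ t ∈ Finset.range T,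
        ((Q t f₀).indicator (fun _ => C) ω + (Q t (f' t)).indicator (fun _ => C) ω) := by
    intro ω
    have hgood := sum_width_le (S := {t ∈ Finset.range T | ω ∉ Q t f₀ ∧ ω ∉ Q t (f' t)})
      (x := fun i => a i ω) (f := fun t => f' t ω) (g := fun _ => f₀ ω) hκ hC.le hd
      (fun t => (f' t ω).2) (fun _ => (f₀ ω).2) hB0 (Finset.filter_subset _ _)
      (fun t _ => hdiff _ _ _) (fun t ht => sum_sq_sub_le_of_not_isFarFromFit hN
        (Finset.mem_filter.1 ht).2.2 (Finset.mem_filter.1 ht).2.1)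
    refine le_trans ?_ (add_le_add_left hgood _)
    rw [Finset.sum_filter, ← Finset.sum_add_distrib]
    refine Finset.sum_le_sum fun t _ => ?_
    have h := hdiff (f' t ω) (f₀ ω) (a t ω)
    by_cases h1 : ω ∈ Q t f₀ <;> by_cases h2 : ω ∈ Q t (f' t) <;> simp [h1, h2] <;> linarith
  have hval : ∀ {g : Ω → F}, Measurable g → ∀ t < T,
      Integrable (fun ω => (g ω : A → ℝ) (a t ω)) P := fun hg t ht =>
    integrable_eval hF heval hg (hmodel.measurable_action t ht)
  have hsum : ∀ t ∈ Finset.range T, Integrable (fun ω =>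
      (Q t f₀).indicator (fun _ => C) ω + (Q t (f' t)).indicator (fun _ => C) ω) P := by
    intro t ht
    have ht := Finset.mem_range.1 ht
    exact (hind t ht _ hmodel.measurable_f₀).add (hind t ht _ (hTS.measurable_sample t ht))
  refine (integral_mono (integrable_finsetSum _ fun t ht => ?_)
    ((integrable_const _).add (integrable_finsetSum _ hsum)) hpath).trans ?_
  · have ht := Finset.mem_range.1 ht
    exact (hval (hTS.measurable_sample t ht) t ht).sub (hval hmodel.measurable_f₀ t ht)
  · rw [integral_add' (integrable_const _) (integrable_finsetSum _ hsum), integral_const,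
      probReal_univ, one_smul, integral_finsetSum _ hsum]
    have hbad : ∑ t ∈ Finset.range T, ∫ ω,
        ((Q t f₀).indicator (fun _ => C) ω + (Q t (f' t)).indicator (fun _ => C) ω) ∂P ≤
        ∑ t ∈ Finset.range T, 2 * δ * C := by
      refine Finset.sum_le_sum fun t ht => ?_
      have ht := Finset.mem_range.1 ht
      rw [integral_add (hind t ht _ hmodel.measurable_f₀)
          (hind t ht _ (hTS.measurable_sample t ht)),
        integral_indicator_const _ (hQm t ht _ hmodel.measurable_f₀),
        integral_indicator_const _ (hQm t ht _ (hTS.measurable_sample t ht)), smul_eq_mul,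
        smul_eq_mul]
      nlinarith [hQ₀ t ht, hQ' t ht]
    rw [Finset.sum_const, Finset.card_range, nsmul_eq_mul] at hbad
    nlinarith

theorem ofReal_regret_bound {κ : ℝ≥0} {C B : ℝ} (hC : 0 ≤ C) (hB : 0 ≤ B) (T d : ℕ) :
    ENNReal.ofReal (T * κ + (d + 1) * C + 4 * Real.sqrt (d * B * T)) =
      (T : ℝ≥0∞) * κ + ((d : ℝ≥0∞) + 1) * ENNReal.ofReal C
        + 4 * ((d : ℝ≥0∞) * ENNReal.ofReal B * T) ^ (1 / 2 : ℝ) := by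
  rw [ENNReal.ofReal_add (by positivity) (by positivity),
    ENNReal.ofReal_add (by positivity) (by positivity), ENNReal.ofReal_mul (by positivity),
    ENNReal.ofReal_mul (by positivity), ENNReal.ofReal_mul (by positivity),
    ENNReal.ofReal_add (by positivity) zero_le_one, Real.sqrt_eq_rpow,
    ← ENNReal.ofReal_rpow_of_nonneg (by positivity) (by norm_num),
    ENNReal.ofReal_mul (by positivity), ENNReal.ofReal_mul (by positivity)]
  simp

theorem theorem1 {Ω A : Type*} [MeasurableSpace Ω] [MeasurableSpace A]
    (P : Measure Ω) [IsProbabilityMeasure P]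
    (F : Set (A → ℝ)) [MeasurableSpace F] (p₀ : Measure F)
    (C σ b : ℝ) (hC : 0 < C) (hσ : 0 ≤ σ) (hb : 0 < b)
    (hF : ∀ f ∈ F, ∀ x : A, f x ∈ Set.Icc 0 C)
    (heval : Measurable fun p : F × A => (p.1 : A → ℝ) p.2)
    (hmax : AEMeasurable (fun f : F => ⨆ x : A, (f : A → ℝ) x) p₀)
    (T : ℕ) (hT : 1 ≤ T)
    (f₀ : Ω → F) (f' : ℕ → Ω → F) (a : ℕ → Ω → A) (R : ℕ → Ω → ℝ)
    (hmodel : IsBanditModel P p₀ σ b T f₀ a R)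
    (hTS : IsThompsonSampling P T f₀ f' a R)
    (κ : ℕ → ℝ≥0) (hκ : Antitone κ)
    (α δ l : ℝ) (hα : 0 < α) (hδ : 0 < δ) (hδT : δ ≤ 1 / (2 * T))
    (hl : 0 < l) (hlb : |l| ≤ (2 * C * b)⁻¹) (hlσ : 2 * l * σ ^ 2 < 1) :
    bayesRegret P T f₀ a ≤
      (T : ℝ≥0∞) * κ T
        + ((eluderDim F (κ T) : ℝ≥0∞) + 1) * ENNReal.ofReal C
        + 4 * ((eluderDim F (κ T) : ℝ≥0∞) * ballWidth F C σ b δ α l T * T) ^ (1 / 2 : ℝ) := by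
  have hTpos : (0 : ℝ) < T := by exact_mod_cast hT
  rcases hd : eluderDim F (κ T) with _ | d
  · have : ((⊤ : ℕ∞) : ℝ≥0∞) = ⊤ := rfl
    refine le_of_le_of_eq le_top (Eq.symm ?_)
    change _ + (((⊤ : ℕ∞) : ℝ≥0∞) + 1) * _ + _ = _
    rw [this, top_add, ENNReal.top_mul (ENNReal.ofReal_pos.2 hC).ne', add_top, top_add]
  change eluderDim F (κ T) = (d : ℕ∞) at hd
  change _ ≤ _ + (((d : ℕ∞) : ℝ≥0∞) + 1) * _ + 4 * (((d : ℕ∞) : ℝ≥0∞) * _ * _) ^ (1 / 2 : ℝ)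
  rw [ENat.toENNReal_coe]
  by_cases hN : supCoveringNumber F α = ⊤
  · rcases Nat.eq_zero_or_pos d with rfl | hdpos
    · -- In dimension zero all functions are within `κ T` of each other, so no ball is needed.
      have hpath : ∀ ω, ∑ t ∈ Finset.range T,
          ((f' t ω : A → ℝ) (a t ω) - (f₀ ω : A → ℝ) (a t ω)) ≤ T * κ T := by
        intro ω
        have hdiff : ∀ f g : F, ∀ x, |(f : A → ℝ) x - (g : A → ℝ) x| ≤ C := fun f g x => by
          have h1 := hF f f.2 x
          have h2 := hF g g.2 x
          exact abs_le.2 ⟨by linarith [h1.1, h2.2], by linarith [h1.2, h2.1]⟩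
        have := sum_width_le (S := Finset.range T) (x := fun i => a i ω) (f := fun t => f' t ω)
          (g := fun _ => f₀ ω) (β := T * C ^ 2) (κ T).2 hC.le hd (fun t => (f' t ω).2)
          (fun _ => (f₀ ω).2) (by positivity) subset_rfl
          (fun t _ => (le_abs_self _).trans (hdiff _ _ _)) (fun t ht => by
            have h1 : ∑ i ∈ Finset.range t, ((f' t ω : A → ℝ) (a i ω) - (f₀ ω : A → ℝ) (a i ω)) ^ 2
                ≤ ∑ _i ∈ Finset.range t, C ^ 2 := Finset.sum_le_sum fun i _ =>
              sq_le_sq' (abs_le.1 (hdiff _ _ _)).1 (abs_le.1 (hdiff _ _ _)).2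
            rw [Finset.sum_const, Finset.card_range, nsmul_eq_mul] at h1
            have h2 : (t : ℝ) ≤ T := by exact_mod_cast (Finset.mem_range.1 ht).le
            nlinarith [mul_le_mul_of_nonneg_right h2 (sq_nonneg C),
              mul_nonneg hTpos.le (sq_nonneg C)])
        simpa using this
      rw [bayesRegret_eq hC hF heval hmax hmodel hTS, add_assoc]
      refine le_trans ?_ le_self_add
      have h1 : (T : ℝ≥0∞) * κ T = ENNReal.ofReal (T * κ T) := by
        rw [ENNReal.ofReal_mul hTpos.le]; simp
      rw [h1]
      refine ENNReal.ofReal_le_ofReal ?_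
      by_cases hint : Integrable (fun ω => ∑ t ∈ Finset.range T,
          ((f' t ω : A → ℝ) (a t ω) - (f₀ ω : A → ℝ) (a t ω))) P
      · simpa using integral_mono hint (integrable_const _) hpath
      · rw [integral_undef hint]
        positivity
    · refine le_of_le_of_eq le_top (Eq.symm ?_)
      have h1 : ballWidth F C σ b δ α l T = ⊤ := if_pos hN
      have h2 : (d : ℝ≥0∞) ≠ 0 := by exact_mod_cast hdpos.ne'
      have h3 : (T : ℝ≥0∞) ≠ 0 := by exact_mod_cast (Nat.pos_of_ne_zero (by omega)).ne'
      rw [h1, ENNReal.mul_top h2, ENNReal.top_mul h3, ENNReal.top_rpow_of_pos (by norm_num),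
        ENNReal.mul_top (by norm_num), add_top]
  · obtain ⟨c, hcF, hcard, hcov⟩ := exists_finset_cover hα.le hN
    have hΩ : Nonempty Ω := nonempty_of_isProbabilityMeasure P
    have hcpos : 0 < c.card := by
      obtain ⟨g, hg, -⟩ := hcov _ (f₀ hΩ.some).2
      exact Finset.card_pos.2 ⟨g, hg⟩
    have hδT' : 2 * T * δ ≤ 1 := by
      rw [le_div_iff₀ (by positivity)] at hδT
      linarith
    have hδ1 : δ ≤ 1 := by
      have : (1 : ℝ) ≤ T := by exact_mod_cast hT
      nlinarith
    have hN1 : (1 : ℝ) ≤ c.card := by exact_mod_cast hcpos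
    obtain ⟨r, hr, hrl, hu, hB⟩ := exists_rate (σ := σ) (T := T) hN1 hC hb hα hδ hδ1 hl hlσ
    set B := ballWidthFormula c.card C σ b δ α l T with hBdef
    have hlog : 0 ≤ Real.log (c.card / δ) :=
      Real.log_nonneg ((one_le_div hδ).2 (hδ1.trans hN1))
    have hB0 : 0 ≤ B := by
      have h1 : 0 ≤ (1 - 2 * r * σ ^ 2) * B := le_trans (by positivity) hB
      have h2 : 0 < 1 - 2 * r * σ ^ 2 := by nlinarith [mul_le_mul_of_nonneg_right hrl (sq_nonneg σ)]
      exact nonneg_of_mul_nonneg_right h1 h2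
    have hrb : 2 * r * C ≤ 1 / b := by
      have h1 := (hrl.trans (le_abs_self l)).trans hlb
      rw [← one_div, le_div_iff₀ (by positivity)] at h1
      rw [le_div_iff₀ hb]
      linarith
    have hwidth : ballWidth F C σ b δ α l T = ENNReal.ofReal B := by
      rw [ballWidth, if_neg hN, ← hcard]
    rw [hwidth, ← ofReal_regret_bound hC.le hB0, bayesRegret_eq hC hF heval hmax hmodel hTS]
    refine ENNReal.ofReal_le_ofReal ?_
    refine integral_sum_excess_le hC hb hF heval hmodel hTS (κ T).2 hd hα hδ hδT' hcpos
      (c := fun j => (c.equivFin.symm j : A → ℝ)) (fun j => hcF _ (Subtype.prop _)) ?_ hr hrb hu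
      hB0 hB
    intro f hf
    obtain ⟨g, hg, hfg⟩ := hcov f hf
    exact ⟨c.equivFin ⟨g, hg⟩, by simpa using hfg⟩
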